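/- Let $\varphi: M^2\to\mathbb{R}^4$ be a smooth immersion of a surface $M$, endowed with the induced metric $g$, with second fundamental form $B$, mean curvature vector field $H=\tfrac12\operatorname{trace}B$ and normal connection $\nabla^\perp$. The surface is called biconservative if $\operatorname{div}S_2=0$, where $S_2$ is the symmetric tensor $S_2=-2|H|^2g+4A_H$, $A_H(\cdot,\cdot)=\langle B(\cdot,\cdot),H\rangle$. Suppose that $\varphi$ is biconservative and that $|H|$ is a nonzero constant. Then every point $p\in M$ with $(\nabla^\perp H)(p)\neq 0$ (hence every point of $M$, if the surface is proper in the sense that $\nabla^\perp H$ vanishes nowhere) has a neighbourhood with smooth coordinates $(u,v)\in I\times J$, $I,J$ open intervals, in which, up to a rigid motion of $\mathbb{R}^4$, the surface is given by $$X(u,v)=(\gamma(u),v+a)=(\gamma^1(u),\gamma^2(u),\gamma^3(u),v+a),\qquad a\in\mathbb{R},$$ where $\gamma:I\to\mathbb{R}^3$ is a smooth curve parametrized by arc length, with constant curvature $k\neq0$ and nowhere vanishing torsion. Conversely, let $k\neq 0$, and let $\varphi:M^2\to\mathbb{R}^4$ be a map that, near every point of $M$, is given in this way (with $\gamma$, $a$,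 the coordinates and the rigid motion depending on the point, but with the same curvature $k$ everywhere). Then $\varphi$ is a smooth immersion, it is biconservative, $|H|$ is a nonzero constant, and $\nabla^\perp H$ vanishes at no point of $M$. -/

import Mathlib

open scoped Manifold ContDiff

noncomputable section

/-! ### Local differential geometry of a parametrized surface `X : ℝ² → ℝ⁴` -/

/-- The partial derivative `∂ᵢ F` of a map defined on (an open subset of) `ℝ²`. -/
def pderivTwo {V : Type*} [NormedAddCommGroup V] [NormedSpace ℝ V] (i : Fin 2)
    (F : EuclideanSpace ℝ (Fin 2) → V) (x : EuclideanSpace ℝ (Fin 2)) : V :=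
  fderiv ℝ F x (EuclideanSpace.single i (1 : ℝ))

namespace ParamSurface

variable (X : EuclideanSpace ℝ (Fin 2) → EuclideanSpace ℝ (Fin 4))

/-- The first fundamental form (induced metric) `gᵢⱼ = ⟨∂ᵢX, ∂ⱼX⟩`. -/
def metric (x : EuclideanSpace ℝ (Fin 2)) : Matrix (Fin 2) (Fin 2) ℝ :=
  Matrix.of fun i j => inner ℝ (pderivTwo i X x) (pderivTwo j X x)

/-- The inverse metric `gⁱʲ`. -/
def metricInv (x : EuclideanSpace ℝ (Fin 2)) : Matrix (Fin 2) (Fin 2) ℝ :=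
  (metric X x)⁻¹

/-- The tangent plane, spanned by `∂₀X` and `∂₁X`. -/
def tangentPlane (x : EuclideanSpace ℝ (Fin 2)) : Submodule ℝ (EuclideanSpace ℝ (Fin 4)) :=
  Submodule.span ℝ (Set.range fun i : Fin 2 => pderivTwo i X x)

/-- The component of `w ∈ ℝ⁴` normal to the surface. -/
def normalPart (x : EuclideanSpace ℝ (Fin 2)) (w : EuclideanSpace ℝ (Fin 4)) :
    EuclideanSpace ℝ (Fin 4) :=
  (tangentPlane X x)ᗮ.starProjection w

/-- The second fundamental form `B(∂ᵢ, ∂ⱼ) = (∂ᵢ∂ⱼX)^⊥`. -/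
def secondFundForm (i j : Fin 2) (x : EuclideanSpace ℝ (Fin 2)) : EuclideanSpace ℝ (Fin 4) :=
  normalPart X x (pderivTwo i (pderivTwo j X) x)

/-- The mean curvature vector field `H = (1/2) trace B`. -/
def meanCurvature (x : EuclideanSpace ℝ (Fin 2)) : EuclideanSpace ℝ (Fin 4) :=
  (1 / 2 : ℝ) • ∑ i : Fin 2, ∑ j : Fin 2, metricInv X x i j • secondFundForm X i j x

/-- The normal covariant derivative `∇^⊥_{∂ᵢ} H = (∂ᵢH)^⊥`. -/
def normalDerivMeanCurvature (i : Fin 2) (x : EuclideanSpace ℝ (Fin 2)) :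
    EuclideanSpace ℝ (Fin 4) :=
  normalPart X x (pderivTwo i (meanCurvature X) x)

/-- The stress-bienergy tensor `S₂ = -2 |H|² g + 4 A_H`, where
`A_H(∂ᵢ, ∂ⱼ) = ⟨B(∂ᵢ, ∂ⱼ), H⟩`. -/
def stressBienergy (i j : Fin 2) (x : EuclideanSpace ℝ (Fin 2)) : ℝ :=
  -2 * ‖meanCurvature X x‖ ^ 2 * metric X x i j
    + 4 * inner ℝ (secondFundForm X i j x) (meanCurvature X x)

/-- The Christoffel symbols `Γˡᵢⱼ` of the induced metric. -/
def christoffel (l i j : Fin 2) (x : EuclideanSpace ℝ (Fin 2)) : ℝ :=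
  (1 / 2 : ℝ) * ∑ m : Fin 2, metricInv X x l m *
    (pderivTwo i (fun y => metric X y j m) x + pderivTwo j (fun y => metric X y i m) x
      - pderivTwo m (fun y => metric X y i j) x)

/-- The covariant derivative `(∇_{∂ᵢ} S₂)(∂ⱼ, ∂ₖ)`, for the Levi-Civita connection of the
induced metric. -/
def covDerivStress (i j k : Fin 2) (x : EuclideanSpace ℝ (Fin 2)) : ℝ :=
  pderivTwo i (stressBienergy X j k) x
    - ∑ l : Fin 2, christoffel X l i j x * stressBienergy X l k x
    - ∑ l : Fin 2, christoffel X l i k x * stressBienergy X j l x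

/-- The divergence `(div S₂)(∂ₖ) = gⁱʲ (∇_{∂ᵢ} S₂)(∂ⱼ, ∂ₖ)`. -/
def divStress (k : Fin 2) (x : EuclideanSpace ℝ (Fin 2)) : ℝ :=
  ∑ i : Fin 2, ∑ j : Fin 2, metricInv X x i j * covDerivStress X i j k x

end ParamSurface

/-! ### Immersed surfaces `φ : M² → ℝ⁴`

The surface carries the metric induced by `φ`. Its tensors are computed in the charts of the
atlas of `M`, through the local parametrizations `φ ∘ e⁻¹`. -/

section ImmersedSurface

variable {M : Type*} [TopologicalSpace M] [ChartedSpace (EuclideanSpace ℝ (Fin 2)) M]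

/-- `φ` is a smooth immersion. -/
def IsSmoothImmersion (φ : M → EuclideanSpace ℝ (Fin 4)) : Prop :=
  ContMDiff (𝓡 2) 𝓘(ℝ, EuclideanSpace ℝ (Fin 4)) ∞ φ ∧
    ∀ p : M, Function.Injective (mfderiv (𝓡 2) 𝓘(ℝ, EuclideanSpace ℝ (Fin 4)) φ p)

/-- The immersed surface is biconservative: `div S₂ = 0`. -/
def IsBiconservative (φ : M → EuclideanSpace ℝ (Fin 4)) : Prop :=
  ∀ e ∈ atlas (EuclideanSpace ℝ (Fin 2)) M, ∀ x ∈ e.target, ∀ k : Fin 2,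
    ParamSurface.divStress (φ ∘ e.symm) k x = 0

/-- The mean curvature `|H|` of the immersed surface is constant and different from zero. -/
def HasNonzeroConstantMeanCurvature (φ : M → EuclideanSpace ℝ (Fin 4)) : Prop :=
  ∃ h : ℝ, h ≠ 0 ∧ ∀ e ∈ atlas (EuclideanSpace ℝ (Fin 2)) M, ∀ x ∈ e.target,
    ‖ParamSurface.meanCurvature (φ ∘ e.symm) x‖ = h

/-- `(∇^⊥ H)(p) = 0`. The surface is PMC if this holds at every point `p`. -/
def IsParallelMeanCurvatureAt (φ : M → EuclideanSpace ℝ (Fin 4)) (p : M) : Prop :=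
  ∀ i : Fin 2, ParamSurface.normalDerivMeanCurvature
    (φ ∘ (chartAt (EuclideanSpace ℝ (Fin 2)) p).symm) i
    (chartAt (EuclideanSpace ℝ (Fin 2)) p p) = 0

end ImmersedSurface

/-! ### Curves in `ℝ³` parametrized by arc length -/

namespace ArcLengthCurve

variable (γ : ℝ → EuclideanSpace ℝ (Fin 3))

/-- The curvature `|γ''|`. -/
def curvature (u : ℝ) : ℝ := ‖deriv (deriv γ) u‖

/-- The principal normal `N = γ'' / |γ''|`. -/
def principalNormal (u : ℝ) : EuclideanSpace ℝ (Fin 3) :=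
  (curvature γ u)⁻¹ • deriv (deriv γ) u

/-- The binormal `B = γ' × N`. -/
def binormal (u : ℝ) : EuclideanSpace ℝ (Fin 3) :=
  WithLp.toLp 2 (crossProduct (deriv γ u).ofLp (principalNormal γ u).ofLp)

/-- The torsion, given by the Frenet equation `N' = -k γ' + τ B`. -/
def torsion (u : ℝ) : ℝ := inner ℝ (deriv (principalNormal γ) u) (binormal γ u)

end ArcLengthCurve

/-- `γ : I → ℝ³` is a smooth curve parametrized by arc length, with constant curvature `k` and
torsion that vanishes nowhere. -/
structure IsConstCurvatureTwistedCurve (I : Set ℝ) (γ : ℝ → EuclideanSpace ℝ (Fin 3))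
    (k : ℝ) : Prop where
  contDiffOn : ContDiffOn ℝ ∞ γ I
  norm_deriv : ∀ u ∈ I, ‖deriv γ u‖ = 1
  curvature_eq : ∀ u ∈ I, ArcLengthCurve.curvature γ u = k
  torsion_ne_zero : ∀ u ∈ I, ArcLengthCurve.torsion γ u ≠ 0

/-- The parametrization `X(u, v) = (γ¹(u), γ²(u), γ³(u), v + a)`. -/
def cylinderParam (γ : ℝ → EuclideanSpace ℝ (Fin 3)) (a : ℝ) (x : EuclideanSpace ℝ (Fin 2)) :
    EuclideanSpace ℝ (Fin 4) :=
  !₂[γ (x 0) 0, γ (x 0) 1, γ (x 0) 2, x 1 + a]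

/-- Near `p`, there are smooth coordinates `(u, v) ∈ I × J` of the surface, `I` and `J` open
intervals, in which `φ` is, up to a rigid motion `Φ` of `ℝ⁴`, the parametrization
`(γ(u), v + a)`, where `γ : I → ℝ³` is an arc length curve of constant curvature `k` and
nowhere vanishing torsion. -/
def IsTwistedCylinderNear {M : Type*} [TopologicalSpace M]
    [ChartedSpace (EuclideanSpace ℝ (Fin 2)) M]
    (φ : M → EuclideanSpace ℝ (Fin 4)) (k : ℝ) (p : M) : Prop :=
  ∃ (Φ : EuclideanSpace ℝ (Fin 4) ≃ᵃⁱ[ℝ] EuclideanSpace ℝ (Fin 4)) (I J : Set ℝ)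
    (γ : ℝ → EuclideanSpace ℝ (Fin 3)) (a : ℝ)
    (e : OpenPartialHomeomorph M (EuclideanSpace ℝ (Fin 2))),
    IsOpen I ∧ I.OrdConnected ∧ IsOpen J ∧ J.OrdConnected ∧
    IsConstCurvatureTwistedCurve I γ k ∧
    e ∈ IsManifold.maximalAtlas (𝓡 2) ∞ M ∧ p ∈ e.source ∧
    e.target = {x | x 0 ∈ I ∧ x 1 ∈ J} ∧
    ∀ x ∈ e.target, Φ (φ (e.symm x)) = cylinderParam γ a x

end

/-! ### Partial derivatives in the plane -/

/-! Both directions rest on one identity: if |H| is constant, the Codazzi equation reduces div S₂ to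
4 trace A_{∇^⊥H} (`divStress_eq`).

For the direct statement, put h = |H| and work near a point where ∇^⊥H ≠ 0. Let n = H/h, and let m
be a unit normal along one nonzero component of ∇^⊥H, so that ∇^⊥H = h α ⊗ m with a nonvanishing
1-form α. Biconservativity puts the vector dual to α in the kernel of A_m. Moreover A_m is
trace-free because m ⊥ H, and in dimension two these facts force A_m = 0
(`eq_zero_of_trace_eq_zero_of_sharp`, `exists_isAdaptedFrame`). Let e be the unit tangent vector
dual to α up to scale, f a unit tangent vector orthogonal to it, and θ = ⟨e, dX⟩. Now dm = -ρ θ n,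
and the symmetry of the second derivatives of m forces A_n = 2h θ ⊗ θ (`codazzi`,
`inner_n_pderivTwo_pderivTwo`). The symmetry of the second derivatives of n and X then kills the
connection form ⟨e, df⟩ (`inner_e_pderivTwo_f`). Hence f is constant, and e, n, m obey the Frenet
equations relative to θ, with curvature 2h and torsion ρ. The form θ is closed, θ = du; with v = ⟨f,
X⟩ the vector X - v f depends on u alone and traces the curve (`exists_cylinder_chart`).

Conversely, a cylinder over a curve with Frenet frame T, N, B has second fundamental form k du² N,
hence H = (k/2) N and ∇^⊥H = (k/2) τ du ⊗ B. This is nonzero, and orthogonal to the second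
fundamental form, so the trace above vanishes (`cylinder_geometry`). -/

abbrev Plane := EuclideanSpace ℝ (Fin 2)

abbrev Space4 := EuclideanSpace ℝ (Fin 4)

section PartialDerivatives

variable {V : Type*} [NormedAddCommGroup V] [NormedSpace ℝ V] {U : Set Plane}

theorem ContDiffOn.pderivTwo {F : Plane → V} (hF : ContDiffOn ℝ ∞ F U) (hU : IsOpen U)
    (i : Fin 2) : ContDiffOn ℝ ∞ (pderivTwo i F) U :=
  (hF.fderiv_of_isOpen hU (by simp)).clm_apply contDiffOn_const

theorem ContDiffOn.differentiableAt_of_isOpen {F : Plane → V} (hF : ContDiffOn ℝ ∞ F U)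
    (hU : IsOpen U) {x : Plane} (hx : x ∈ U) : DifferentiableAt ℝ F x :=
  (hF.contDiffAt (hU.mem_nhds hx)).differentiableAt (by simp)

theorem pderivTwo_congr {F G : Plane → V} (hU : IsOpen U) (h : Set.EqOn F G U) {x : Plane}
    (hx : x ∈ U) (i : Fin 2) : pderivTwo i F x = pderivTwo i G x := by
  rw [pderivTwo, pderivTwo, (h.eventuallyEq_of_mem (hU.mem_nhds hx)).fderiv_eq]

theorem pderivTwo_comm {F : Plane → V} (hU : IsOpen U) (hF : ContDiffOn ℝ ∞ F U) {x : Plane}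
    (hx : x ∈ U) (i j : Fin 2) :
    pderivTwo i (pderivTwo j F) x = pderivTwo j (pderivTwo i F) x := by
  have hd : DifferentiableAt ℝ (fderiv ℝ F) x :=
    (hF.fderiv_of_isOpen hU (m := ∞) (by simp)).differentiableAt_of_isOpen hU hx
  have key : ∀ a b : Fin 2, pderivTwo a (pderivTwo b F) x =
      fderiv ℝ (fderiv ℝ F) x (EuclideanSpace.single a 1) (EuclideanSpace.single b 1) := by
    intro a b
    change fderiv ℝ (fun y => fderiv ℝ F y (EuclideanSpace.single b 1)) x _ = _
    rw [fderiv_clm_apply hd (differentiableAt_const _)]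
    simp
  rw [key, key]
  exact (hF.contDiffAt (hU.mem_nhds hx)).isSymmSndFDerivAt
    (by rw [minSmoothness_of_isRCLikeNormedField]; exact ENat.LEInfty.out) _ _

theorem pderivTwo_inner {W : Type*} [NormedAddCommGroup W] [InnerProductSpace ℝ W]
    {F G : Plane → W} {x : Plane} (hF : DifferentiableAt ℝ F x) (hG : DifferentiableAt ℝ G x)
    (i : Fin 2) :
    pderivTwo i (fun y => inner ℝ (F y) (G y)) x =
      inner ℝ (pderivTwo i F x) (G x) + inner ℝ (F x) (pderivTwo i G x) := by
  simp only [pderivTwo]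
  rw [fderiv_inner_apply ℝ hF hG, add_comm]

/-- Differentiating a constant inner product. -/
theorem inner_pderivTwo_add_eq_zero {W : Type*} [NormedAddCommGroup W] [InnerProductSpace ℝ W]
    {F G : Plane → W} (hU : IsOpen U) (hF : ContDiffOn ℝ ∞ F U) (hG : ContDiffOn ℝ ∞ G U)
    {c : ℝ} (h : ∀ y ∈ U, inner ℝ (F y) (G y) = c) {x : Plane} (hx : x ∈ U) (i : Fin 2) :
    inner ℝ (pderivTwo i F x) (G x) + inner ℝ (F x) (pderivTwo i G x) = 0 := by
  rw [← pderivTwo_inner (hF.differentiableAt_of_isOpen hU hx)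
    (hG.differentiableAt_of_isOpen hU hx), pderivTwo_congr hU (G := fun _ => c) h hx]
  simp [pderivTwo]

theorem fderiv_eq_sum_pderivTwo (F : Plane → V) (x w : Plane) :
    fderiv ℝ F x w = ∑ i, w i • pderivTwo i F x := by
  conv_lhs => rw [← (EuclideanSpace.basisFun (Fin 2) ℝ).sum_repr w]
  simp [pderivTwo]

end PartialDerivatives

/-! ### Pointwise geometry of a regular parametrized surface -/

namespace ParamSurface

variable {X : Plane → Space4} {x : Plane} {U : Set Plane}

/-- `X` is a smooth immersion on the open set `U`. -/
structure IsRegularOn (X : Plane → Space4) (U : Set Plane) : Prop where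
  isOpen : IsOpen U
  contDiffOn : ContDiffOn ℝ ∞ X U
  linearIndependent : ∀ x ∈ U, LinearIndependent ℝ fun i => pderivTwo i X x

theorem pderivTwo_mem_tangentPlane (i : Fin 2) : pderivTwo i X x ∈ tangentPlane X x :=
  Submodule.subset_span ⟨i, rfl⟩

theorem mem_tangentPlane_orthogonal {n : Space4} :
    n ∈ (tangentPlane X x)ᗮ ↔ ∀ i, inner ℝ n (pderivTwo i X x) = 0 := by
  rw [Submodule.mem_orthogonal']
  constructor
  · exact fun h i => h _ (pderivTwo_mem_tangentPlane i)
  · intro h u hu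
    induction hu using Submodule.span_induction with
    | mem u hu => obtain ⟨i, rfl⟩ := hu; exact h i
    | zero => simp
    | add u v _ _ hu hv => rw [inner_add_right, hu, hv, add_zero]
    | smul c u _ hu => rw [inner_smul_right, hu, mul_zero]

theorem normalPart_eq {w n : Space4} (hn : ∀ i, inner ℝ n (pderivTwo i X x) = 0)
    (ht : w - n ∈ tangentPlane X x) : normalPart X x w = n :=
  Submodule.eq_starProjection_of_mem_orthogonal (mem_tangentPlane_orthogonal.2 hn)
    (Submodule.le_orthogonal_orthogonal _ ht)

theorem inner_normalPart_pderivTwo (w : Space4) (i : Fin 2) :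
    inner ℝ (normalPart X x w) (pderivTwo i X x) = 0 :=
  mem_tangentPlane_orthogonal.1 (Submodule.starProjection_apply_mem _ w) i

theorem inner_normalPart_left (w : Space4) {n : Space4}
    (hn : ∀ i, inner ℝ n (pderivTwo i X x) = 0) :
    inner ℝ (normalPart X x w) n = inner ℝ w n := by
  rw [normalPart, Submodule.inner_starProjection_left_eq_right,
    Submodule.starProjection_eq_self_iff.2 (mem_tangentPlane_orthogonal.2 hn)]

theorem inner_meanCurvature_pderivTwo (i : Fin 2) :
    inner ℝ (meanCurvature X x) (pderivTwo i X x) = 0 := by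
  simp [meanCurvature, secondFundForm, real_inner_smul_left, inner_add_left,
    inner_normalPart_pderivTwo, -smul_add]

theorem inner_secondFundForm {n : Space4} (hn : ∀ i, inner ℝ n (pderivTwo i X x) = 0)
    (i j : Fin 2) : inner ℝ (secondFundForm X i j x) n =
      inner ℝ (pderivTwo i (pderivTwo j X) x) n :=
  inner_normalPart_left _ hn

theorem two_mul_inner_meanCurvature {n : Space4} :
    2 * inner ℝ (meanCurvature X x) n =
      ∑ i, ∑ j, metricInv X x i j * inner ℝ (secondFundForm X i j x) n := by
  simp [meanCurvature, real_inner_smul_left, inner_add_left, -smul_add]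

theorem metric_eq_gram : metric X x = Matrix.gram ℝ fun i => pderivTwo i X x := by
  ext i j; simp [metric, Matrix.gram]

theorem metric_det_ne_zero (h : LinearIndependent ℝ fun i => pderivTwo i X x) :
    (metric X x).det ≠ 0 := by
  rw [metric_eq_gram]; exact Matrix.det_gram_ne_zero_iff_linearIndependent.2 h

theorem metric_symm (i j : Fin 2) : metric X x i j = metric X x j i := by
  simp [metric, real_inner_comm]

theorem metricInv_symm (i j : Fin 2) : metricInv X x i j = metricInv X x j i := by
  have : (metricInv X x).transpose = metricInv X x := by
    rw [metricInv, Matrix.transpose_nonsing_inv]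
    congr 1
    ext i j
    exact metric_symm _ _
  exact congrFun (congrFun this j) i

theorem metricInv_mul_metric (h : LinearIndependent ℝ fun i => pderivTwo i X x) :
    metricInv X x * metric X x = 1 :=
  Matrix.nonsing_inv_mul _ (metric_det_ne_zero h).isUnit

theorem metric_mul_metricInv (h : LinearIndependent ℝ fun i => pderivTwo i X x) :
    metric X x * metricInv X x = 1 :=
  Matrix.mul_nonsing_inv _ (metric_det_ne_zero h).isUnit

theorem sum_metricInv_mul_metric (h : LinearIndependent ℝ fun i => pderivTwo i X x)
    (i j : Fin 2) : ∑ l, metricInv X x i l * metric X x l j = if i = j then 1 else 0 := by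
  rw [← Matrix.mul_apply, metricInv_mul_metric h, Matrix.one_apply]

/-- The orthogonal projection onto a moving plane is not visibly smooth in the base point; this
formula in terms of the inverse metric makes it so. -/
theorem normalPart_eq_sub (h : LinearIndependent ℝ fun i => pderivTwo i X x) (w : Space4) :
    normalPart X x w =
      w - ∑ i, ∑ j, (metricInv X x i j * inner ℝ w (pderivTwo i X x)) • pderivTwo j X x := by
  apply normalPart_eq
  · intro k
    have := fun i => sum_metricInv_mul_metric h i k
    simp only [metric, Matrix.of_apply] at this
    simp only [inner_sub_left, sum_inner, inner_smul_left, mul_assoc,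
      RCLike.conj_to_real]
    simp_rw [mul_left_comm (metricInv X x _ _), ← Finset.mul_sum, this]
    simp
  · rw [sub_sub_cancel]
    exact Submodule.sum_mem _ fun i _ => Submodule.sum_mem _ fun j _ =>
      Submodule.smul_mem _ _ (pderivTwo_mem_tangentPlane j)

namespace IsRegularOn

variable (hX : IsRegularOn X U)
include hX

theorem mono {V : Set Plane} (hV : IsOpen V) (h : V ⊆ U) : IsRegularOn X V :=
  ⟨hV, hX.contDiffOn.mono h, fun x hx => hX.linearIndependent x (h hx)⟩

theorem contDiffOn_metric (i j : Fin 2) : ContDiffOn ℝ ∞ (fun y => metric X y i j) U :=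
  (hX.contDiffOn.pderivTwo hX.isOpen i).inner ℝ (hX.contDiffOn.pderivTwo hX.isOpen j)

theorem contDiffOn_metricInv (i j : Fin 2) : ContDiffOn ℝ ∞ (fun y => metricInv X y i j) U := by
  have hdet : ContDiffOn ℝ ∞ (fun y => ((metric X y).det)⁻¹) U := by
    refine ContDiffOn.inv ?_ fun y hy => metric_det_ne_zero (hX.linearIndependent y hy)
    simp_rw [Matrix.det_fin_two]
    exact ((hX.contDiffOn_metric 0 0).mul (hX.contDiffOn_metric 1 1)).sub
      ((hX.contDiffOn_metric 0 1).mul (hX.contDiffOn_metric 1 0))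
  simp_rw [metricInv, Matrix.inv_def, Ring.inverse_eq_inv', Matrix.smul_apply, smul_eq_mul]
  refine hdet.mul ?_
  simp_rw [Matrix.adjugate_fin_two]
  fin_cases i <;> fin_cases j
  · exact hX.contDiffOn_metric 1 1
  · exact (hX.contDiffOn_metric 0 1).neg
  · exact (hX.contDiffOn_metric 1 0).neg
  · exact hX.contDiffOn_metric 0 0

theorem contDiffOn_normalPart {w : Plane → Space4} (hw : ContDiffOn ℝ ∞ w U) :
    ContDiffOn ℝ ∞ (fun y => normalPart X y (w y)) U := by
  refine ContDiffOn.congr (f := fun y => w y - ∑ i, ∑ j,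
    (metricInv X y i j * inner ℝ (w y) (pderivTwo i X y)) • pderivTwo j X y) ?_
    fun y hy => normalPart_eq_sub (hX.linearIndependent y hy) _
  refine hw.sub (ContDiffOn.sum fun i _ => ContDiffOn.sum fun j _ => ?_)
  exact ((hX.contDiffOn_metricInv i j).mul (hw.inner ℝ (hX.contDiffOn.pderivTwo hX.isOpen i))).smul
    (hX.contDiffOn.pderivTwo hX.isOpen j)

theorem contDiffOn_pderivTwo (i : Fin 2) : ContDiffOn ℝ ∞ (pderivTwo i X) U :=
  hX.contDiffOn.pderivTwo hX.isOpen i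

theorem contDiffOn_secondFundForm (i j : Fin 2) : ContDiffOn ℝ ∞ (secondFundForm X i j) U :=
  hX.contDiffOn_normalPart ((hX.contDiffOn_pderivTwo j).pderivTwo hX.isOpen i)

theorem contDiffOn_meanCurvature : ContDiffOn ℝ ∞ (meanCurvature X) U :=
  (ContDiffOn.sum fun i _ => ContDiffOn.sum fun j _ =>
    (hX.contDiffOn_metricInv i j).smul (hX.contDiffOn_secondFundForm i j)).const_smul _

theorem contDiffOn_normalDerivMeanCurvature (i : Fin 2) :
    ContDiffOn ℝ ∞ (normalDerivMeanCurvature X i) U :=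
  hX.contDiffOn_normalPart (hX.contDiffOn_meanCurvature.pderivTwo hX.isOpen i)

end IsRegularOn

end ParamSurface

/-! ### The divergence of the stress-bienergy tensor -/

namespace ParamSurface

variable {X : Plane → Space4} {x : Plane} {U : Set Plane}

namespace IsRegularOn

variable (hX : IsRegularOn X U)
include hX

theorem pderivTwo_metric (hx : x ∈ U) (k i j : Fin 2) :
    pderivTwo k (fun y => metric X y i j) x =
      inner ℝ (pderivTwo k (pderivTwo i X) x) (pderivTwo j X x) +
        inner ℝ (pderivTwo k (pderivTwo j X) x) (pderivTwo i X x) := by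
  have hd := fun i => (hX.contDiffOn_pderivTwo i).differentiableAt_of_isOpen hX.isOpen hx
  rw [real_inner_comm (pderivTwo i X x)]
  exact pderivTwo_inner (hd i) (hd j) k

/-- In the Koszul expression every derivative of the metric splits into two products with second
derivatives of `X`; by their symmetry all but two equal terms cancel. -/
theorem sum_christoffel_mul_metric (hx : x ∈ U) (i j k : Fin 2) :
    ∑ l, christoffel X l i j x * metric X x l k =
      inner ℝ (pderivTwo i (pderivTwo j X) x) (pderivTwo k X x) := by
  have h1 := fun m => sum_metricInv_mul_metric (hX.linearIndependent x hx) m k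
  have hc := fun i j => pderivTwo_comm hX.isOpen hX.contDiffOn hx i j
  simp only [christoffel, hX.pderivTwo_metric hx]
  have h2 : ∀ m, ∑ l, metricInv X x l m * metric X x l k = if m = k then 1 else 0 := by
    intro m; rw [← h1 m]; simp only [metricInv_symm m]
  simp only [Fin.sum_univ_two, hc j i, hc 0 i, hc 0 j, hc 1 i, hc 1 j] at h2 ⊢
  have ha := h2 0
  have hb := h2 1
  fin_cases k <;> simp at ha hb ⊢ <;>
  linear_combination inner ℝ (pderivTwo i (pderivTwo j X) x) (pderivTwo 0 X x) * ha +
    inner ℝ (pderivTwo i (pderivTwo j X) x) (pderivTwo 1 X x) * hb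

/-- Gauss formula: the Levi-Civita connection is the tangential part of the flat one. -/
theorem secondFundForm_eq (hx : x ∈ U) (i j : Fin 2) :
    secondFundForm X i j x =
      pderivTwo i (pderivTwo j X) x - ∑ l, christoffel X l i j x • pderivTwo l X x := by
  apply normalPart_eq
  · intro k
    rw [inner_sub_left, ← hX.sum_christoffel_mul_metric hx, sum_inner]
    simp [real_inner_smul_left, metric]
  · rw [sub_sub_cancel]
    exact Submodule.sum_mem _ fun l _ => Submodule.smul_mem _ _ (pderivTwo_mem_tangentPlane l)

/-- Metric compatibility ∇g = 0, transferred to the inverse metric by differentiating g⁻¹ g = 1. -/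
theorem pderivTwo_metricInv (hx : x ∈ U) (k i j : Fin 2) :
    pderivTwo k (fun y => metricInv X y i j) x =
      -∑ a, (metricInv X x i a * christoffel X j k a x +
        metricInv X x j a * christoffel X i k a x) := by
  have hPd : ∀ i j, DifferentiableAt ℝ (fun y => metricInv X y i j) x := fun i j =>
    (hX.contDiffOn_metricInv i j).differentiableAt_of_isOpen hX.isOpen hx
  have hgd : ∀ i j, DifferentiableAt ℝ (fun y => metric X y i j) x := fun i j =>
    (hX.contDiffOn_metric i j).differentiableAt_of_isOpen hX.isOpen hx
  let P := metricInv X x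
  let g := metric X x
  let p : Matrix (Fin 2) (Fin 2) ℝ :=
    Matrix.of fun i j => pderivTwo k (fun y => metricInv X y i j) x
  let dg : Matrix (Fin 2) (Fin 2) ℝ := Matrix.of fun i j => pderivTwo k (fun y => metric X y i j) x
  let G : Matrix (Fin 2) (Fin 2) ℝ := Matrix.of fun l a => christoffel X l k a x
  have hPg : P * g = 1 := metricInv_mul_metric (hX.linearIndependent x hx)
  have hgP : g * P = 1 := metric_mul_metricInv (hX.linearIndependent x hx)
  -- ∇g = 0 in matrix form.
  have hdg : dg = G.transpose * g + g * G := by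
    ext a b
    simp only [dg, Matrix.of_apply, Matrix.add_apply, Matrix.mul_apply, Matrix.transpose_apply, G, g]
    rw [hX.pderivTwo_metric hx, ← hX.sum_christoffel_mul_metric hx,
      ← hX.sum_christoffel_mul_metric hx]
    congr 1
    exact Finset.sum_congr rfl fun l _ => by rw [mul_comm, metric_symm]
  have hder : p * g + P * dg = 0 := by
    ext a b
    have h0 : pderivTwo k (fun y => ∑ l, metricInv X y a l * metric X y l b) x = 0 := by
      rw [pderivTwo_congr hX.isOpen (G := fun _ => if a = b then (1 : ℝ) else 0)
        (fun y hy => sum_metricInv_mul_metric (hX.linearIndependent y hy) a b) hx]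
      simp [pderivTwo]
    rw [Matrix.zero_apply, ← h0]
    simp only [Matrix.add_apply, Matrix.mul_apply, Fin.sum_univ_two, pderivTwo]
    rw [fderiv_fun_add ((hPd _ _).fun_mul (hgd _ _)) ((hPd _ _).fun_mul (hgd _ _)),
      fderiv_fun_mul (hPd _ _) (hgd _ _), fderiv_fun_mul (hPd _ _) (hgd _ _)]
    simp [p, P, dg, g, pderivTwo]
    ring
  have hp : p = -(P * G.transpose + G * P) := by
    calc p = p * g * P := by rw [mul_assoc, hgP, mul_one]
      _ = -(P * dg * P) := by rw [eq_neg_of_add_eq_zero_left hder, neg_mul]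
      _ = -(P * G.transpose + G * P) := by
        rw [hdg]
        congr 1
        calc P * (G.transpose * g + g * G) * P
            = P * G.transpose * (g * P) + P * g * (G * P) := by noncomm_ring
          _ = _ := by rw [hgP, hPg, mul_one, one_mul]
  have := congrFun (congrFun hp i) j
  simp only [p, Matrix.of_apply, Matrix.neg_apply, Matrix.add_apply, Matrix.mul_apply,
    Matrix.transpose_apply, G, P] at this
  rw [this, Finset.sum_add_distrib]
  congr 2
  exact Finset.sum_congr rfl fun a _ => by rw [mul_comm, metricInv_symm]

/-- The derivative of `A_H`, up to the terms involving the Christoffel symbols. -/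
theorem pderivTwo_shape (hx : x ∈ U) (i j k : Fin 2) :
    pderivTwo i (fun y => inner ℝ (secondFundForm X j k y) (meanCurvature X y)) x =
      inner ℝ (pderivTwo i (pderivTwo j (pderivTwo k X)) x) (meanCurvature X x) +
        inner ℝ (secondFundForm X j k x) (normalDerivMeanCurvature X i x) -
        ∑ l, christoffel X l j k x *
          inner ℝ (secondFundForm X i l x) (meanCurvature X x) := by
  have hA := (hX.contDiffOn_pderivTwo k).pderivTwo hX.isOpen j
  have hH := hX.contDiffOn_meanCurvature
  have hn : ∀ y i, inner ℝ (meanCurvature X y) (pderivTwo i X y) = 0 := fun y i =>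
    inner_meanCurvature_pderivTwo i
  -- Weingarten: the tangential part of ∂ᵢH is minus the shape operator of H.
  have htan : ∀ l, inner ℝ (pderivTwo l X x) (pderivTwo i (meanCurvature X) x) =
      -inner ℝ (secondFundForm X i l x) (meanCurvature X x) := by
    intro l
    have := inner_pderivTwo_add_eq_zero hX.isOpen hH (hX.contDiffOn_pderivTwo l)
      (fun y _ => hn y l) hx i
    rw [inner_secondFundForm (hn x), real_inner_comm, real_inner_comm (meanCurvature X x)]
    linarith
  -- The second fundamental form sees only the normal part of ∂ᵢH. Expanding its left-hand
  -- occurrence by the Gauss formula produces the Christoffel terms.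
  have hB : inner ℝ (secondFundForm X j k x) (pderivTwo i (meanCurvature X) x) =
      inner ℝ (secondFundForm X j k x) (normalDerivMeanCurvature X i x) := by
    rw [normalDerivMeanCurvature, real_inner_comm,
      real_inner_comm (normalPart X x (pderivTwo i (meanCurvature X) x)),
      inner_normalPart_left (n := secondFundForm X j k x) _
        fun l => inner_normalPart_pderivTwo _ l]
  conv_lhs at hB => rw [hX.secondFundForm_eq hx j k]
  simp only [inner_sub_left, sum_inner, real_inner_smul_left, htan, mul_neg,
    Finset.sum_neg_distrib] at hB
  have : pderivTwo i (fun y => inner ℝ (secondFundForm X j k y) (meanCurvature X y)) x =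
      pderivTwo i (fun y => inner ℝ (pderivTwo j (pderivTwo k X) y) (meanCurvature X y)) x :=
    pderivTwo_congr hX.isOpen (fun y _ => inner_secondFundForm (hn y) j k) hx i
  rw [this, pderivTwo_inner (hA.differentiableAt_of_isOpen hX.isOpen hx)
    (hH.differentiableAt_of_isOpen hX.isOpen hx)]
  linarith

/-- For a surface with constant `|H|`, the divergence of `S₂` is `4 trace A_{∇^⊥ H}`. -/
theorem divStress_eq {h : ℝ} (hh : ∀ y ∈ U, ‖meanCurvature X y‖ = h) (hx : x ∈ U) (k : Fin 2) :
    divStress X k x = 4 * ∑ i, ∑ j, metricInv X x i j *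
      inner ℝ (secondFundForm X j k x) (normalDerivMeanCurvature X i x) := by
  have hH := hX.contDiffOn_meanCurvature
  have hn : ∀ y i, inner ℝ (meanCurvature X y) (pderivTwo i X y) = 0 := fun y i =>
    inner_meanCurvature_pderivTwo i
  have hσ : ∀ i j, ContDiffOn ℝ ∞
      (fun y => inner ℝ (secondFundForm X i j y) (meanCurvature X y)) U := fun i j =>
    (hX.contDiffOn_secondFundForm i j).inner ℝ hH
  have hPd : ∀ i j, DifferentiableAt ℝ (fun y => metricInv X y i j) x := fun i j =>
    (hX.contDiffOn_metricInv i j).differentiableAt_of_isOpen hX.isOpen hx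
  have hgd : ∀ i j, DifferentiableAt ℝ (fun y => metric X y i j) x := fun i j =>
    (hX.contDiffOn_metric i j).differentiableAt_of_isOpen hX.isOpen hx
  have hσd := fun i j => (hσ i j).differentiableAt_of_isOpen hX.isOpen hx
  -- the derivative of the tensor
  have hS : ∀ i j k, pderivTwo i (stressBienergy X j k) x =
      -2 * h ^ 2 * pderivTwo i (fun y => metric X y j k) x +
        4 * pderivTwo i (fun y => inner ℝ (secondFundForm X j k y) (meanCurvature X y)) x := by
    intro i j k
    rw [pderivTwo_congr hX.isOpen (G := fun y => -2 * h ^ 2 * metric X y j k +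
      4 * inner ℝ (secondFundForm X j k y) (meanCurvature X y))
      (fun y hy => by rw [stressBienergy, hh y hy]) hx]
    simp only [pderivTwo]
    rw [fderiv_fun_add ((hgd j k).const_mul _) ((hσd j k).const_mul _),
      fderiv_const_mul (hgd j k), fderiv_const_mul (hσd j k)]
    simp
  -- the derivative of the trace
  have htr : ∑ i, ∑ j, (pderivTwo k (fun y => metricInv X y i j) x *
      inner ℝ (secondFundForm X i j x) (meanCurvature X x) + metricInv X x i j *
      pderivTwo k (fun y => inner ℝ (secondFundForm X i j y) (meanCurvature X y)) x) = 0 := by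
    have h0 : pderivTwo k (fun y => ∑ i, ∑ j, metricInv X y i j *
        inner ℝ (secondFundForm X i j y) (meanCurvature X y)) x = 0 := by
      rw [pderivTwo_congr hX.isOpen (G := fun _ => 2 * h ^ 2) (fun y hy => by
        simp only [← two_mul_inner_meanCurvature, real_inner_self_eq_norm_sq, hh y hy]) hx]
      simp [pderivTwo]
    rw [← h0]
    have hm := fun i j => (hPd i j).fun_mul (hσd i j)
    simp only [Fin.sum_univ_two, pderivTwo]
    rw [fderiv_fun_add ((hm _ _).fun_add (hm _ _)) ((hm _ _).fun_add (hm _ _)),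
      fderiv_fun_add (hm _ _) (hm _ _), fderiv_fun_add (hm _ _) (hm _ _),
      fderiv_fun_mul (hPd _ _) (hσd _ _), fderiv_fun_mul (hPd _ _) (hσd _ _),
      fderiv_fun_mul (hPd _ _) (hσd _ _), fderiv_fun_mul (hPd _ _) (hσd _ _)]
    simp
    ring
  -- This is 2⟨H, ∇^⊥H⟩ = ∂|H|² = 0.
  have hHD : ∑ i, ∑ j, metricInv X x i j *
      inner ℝ (secondFundForm X i j x) (normalDerivMeanCurvature X k x) = 0 := by
    rw [← two_mul_inner_meanCurvature, normalDerivMeanCurvature, real_inner_comm,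
      inner_normalPart_left _ (hn x)]
    have := inner_pderivTwo_add_eq_zero hX.isOpen hH hH (c := h ^ 2)
      (fun y hy => by rw [real_inner_self_eq_norm_sq, hh y hy]) hx k
    rw [real_inner_comm (pderivTwo k (meanCurvature X) x) (meanCurvature X x)] at this
    linarith
  have hsec : ∀ i j, secondFundForm X i j x = secondFundForm X j i x := fun i j => by
    simp only [secondFundForm, pderivTwo_comm hX.isOpen hX.contDiffOn hx i j]
  -- Symmetry of third derivatives of `X` plays the role of the Codazzi equation in flat ambient
  -- space.
  have hcomm1 : ∀ i j l, pderivTwo i (pderivTwo j (pderivTwo l X)) x =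
      pderivTwo j (pderivTwo i (pderivTwo l X)) x := fun i j l =>
    pderivTwo_comm hX.isOpen (hX.contDiffOn_pderivTwo l) hx i j
  have hcomm2 : ∀ i j l, pderivTwo i (pderivTwo j (pderivTwo l X)) x =
      pderivTwo i (pderivTwo l (pderivTwo j X)) x := fun i j l =>
    pderivTwo_congr hX.isOpen (fun y hy => pderivTwo_comm hX.isOpen hX.contDiffOn hy j l) hx i
  have hΓ : ∀ l, christoffel X l 1 0 x = christoffel X l 0 1 x := fun l => by
    have : (fun y => metric X y 1 0) = fun y => metric X y 0 1 := funext fun y => metric_symm _ _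
    simp only [christoffel, Fin.sum_univ_two, this]
    ring
  have hg : metric X x 1 0 = metric X x 0 1 := metric_symm _ _
  have hP : metricInv X x 1 0 = metricInv X x 0 1 := metricInv_symm _ _
  have hdg : ∀ i j k, pderivTwo i (fun y => metric X y j k) x =
      ∑ l, christoffel X l i j x * metric X x l k + ∑ l, christoffel X l i k x * metric X x j l := by
    intro i j k
    rw [hX.pderivTwo_metric hx, ← hX.sum_christoffel_mul_metric hx,
      ← hX.sum_christoffel_mul_metric hx]
    simp only [metric_symm j]
  simp only [hX.pderivTwo_metricInv hx, hX.pderivTwo_shape hx] at htr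
  simp only [divStress, covDerivStress, hS, hdg, hX.pderivTwo_shape hx, stressBienergy, hh x hx]
  clear hS hdg
  -- The metric part of S₂ is parallel. By Codazzi the rest of the divergence is 4 trace A_{∇^⊥H},
  -- plus 4 times the derivative of the trace of A_H (`htr`), minus 4 times the trace of ⟨B, ∇^⊥ₖH⟩
  -- (`hHD`).
  simp only [Fin.sum_univ_two, hsec 1 0, hΓ, hg, hP] at htr hHD ⊢
  fin_cases k
  · simp only [Fin.zero_eta, Fin.isValue, hcomm1 1 0, hcomm2 0 1 0, hcomm2 1 1 0, hsec 1 0, hΓ]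
      at htr hHD ⊢
    linear_combination 4 * htr - 4 * hHD
  · simp only [Fin.mk_one, Fin.isValue, hcomm1 1 0, hcomm2 0 1 0, hcomm2 1 1 0, hsec 1 0, hΓ]
      at htr hHD ⊢
    linear_combination 4 * htr - 4 * hHD

end IsRegularOn

end ParamSurface

/-! ### Orthonormal frames -/

section Frames

variable {e f n m : Space4}

theorem Orthonormal.eq_sum_of_card_eq_finrank {ι E : Type*} [Fintype ι] [Nonempty ι]
    [NormedAddCommGroup E] [InnerProductSpace ℝ E] [FiniteDimensional ℝ E] {F : ι → E}
    (hF : Orthonormal ℝ F) (hc : Fintype.card ι = Module.finrank ℝ E) (v : E) :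
    v = ∑ a, (inner ℝ (F a) v) • F a := by
  have hs : ⊤ ≤ Submodule.span ℝ (Set.range F) :=
    (hF.linearIndependent.span_eq_top_of_card_eq_finrank' hc).ge
  have := (OrthonormalBasis.mk hF hs).sum_repr' v
  simpa using this.symm

/-- Orthonormality of four vectors of `ℝ⁴`, written out. -/
structure IsFrame (e f n m : Space4) : Prop where
  ee : inner ℝ e e = (1 : ℝ)
  ff : inner ℝ f f = (1 : ℝ)
  nn : inner ℝ n n = (1 : ℝ)
  mm : inner ℝ m m = (1 : ℝ)
  ef : inner ℝ e f = (0 : ℝ)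
  en : inner ℝ e n = (0 : ℝ)
  em : inner ℝ e m = (0 : ℝ)
  fn : inner ℝ f n = (0 : ℝ)
  fm : inner ℝ f m = (0 : ℝ)
  nm : inner ℝ n m = (0 : ℝ)

theorem IsFrame.orthonormal (h : IsFrame e f n m) : Orthonormal ℝ ![e, f, n, m] := by
  rw [orthonormal_iff_ite]
  intro i j
  fin_cases i <;> fin_cases j <;>
    simp [h.ee, h.ff, h.nn, h.mm, h.ef, h.en, h.em, h.fn, h.fm, h.nm, real_inner_comm e,
      real_inner_comm f, real_inner_comm n,
      -inner_self_eq_norm_sq_to_K]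

theorem IsFrame.eq_sum (h : IsFrame e f n m) (v : Space4) :
    v = inner ℝ e v • e + inner ℝ f v • f + inner ℝ n v • n + inner ℝ m v • m := by
  simpa [Fin.sum_univ_four] using h.orthonormal.eq_sum_of_card_eq_finrank (by simp) v

theorem IsFrame.eq_zero (h : IsFrame e f n m) {v : Space4} (h1 : inner ℝ e v = (0 : ℝ))
    (h2 : inner ℝ f v = (0 : ℝ)) (h3 : inner ℝ n v = (0 : ℝ)) (h4 : inner ℝ m v = (0 : ℝ)) :
    v = 0 := by
  rw [h.eq_sum v, h1, h2, h3, h4]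
  simp

theorem IsFrame.inner_eq (h : IsFrame e f n m) (v w : Space4) :
    inner ℝ v w = (inner ℝ e v * inner ℝ e w + inner ℝ f v * inner ℝ f w +
      inner ℝ n v * inner ℝ n w + inner ℝ m v * inner ℝ m w : ℝ) := by
  conv_lhs => rw [h.eq_sum v]
  simp [inner_add_left, real_inner_smul_left]

end Frames

/-! ### Orthonormal coframes of the tangent plane -/

namespace ParamSurface

variable {X : Plane → Space4} {x : Plane} {e f : Space4} {θ ψ : Fin 2 → ℝ}

theorem det_coframe_ne_zero (hli : LinearIndependent ℝ fun i => pderivTwo i X x)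
    (hX : ∀ i, pderivTwo i X x = θ i • e + ψ i • f) : θ 0 * ψ 1 - θ 1 * ψ 0 ≠ 0 := by
  intro h0
  rw [Fintype.linearIndependent_iff] at hli
  -- If the determinant vanishes, these coefficients and those of the next step give relations
  -- between the two partial derivatives, so θ = ψ = 0 and both derivatives are zero.
  have h1 := hli ![θ 1, -θ 0] (by
    simp only [Fin.sum_univ_two, hX, Matrix.cons_val_zero, Matrix.cons_val_one]
    linear_combination (norm := module) -(h0 • f))
  have h2 := hli ![ψ 1, -ψ 0] (by
    simp only [Fin.sum_univ_two, hX, Matrix.cons_val_zero, Matrix.cons_val_one]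
    linear_combination (norm := module) h0 • e)
  have h3 := hli ![1, 0] (by
    have a := h1 1
    have b := h2 1
    simp at a b
    simp [Fin.sum_univ_two, hX, a, b]) 0
  simp at h3

theorem linearIndependent_of_coframe (hee : inner ℝ e e = (1 : ℝ)) (hff : inner ℝ f f = (1 : ℝ))
    (hef : inner ℝ e f = (0 : ℝ)) (hX : ∀ i, pderivTwo i X x = θ i • e + ψ i • f)
    (hd : θ 0 * ψ 1 - θ 1 * ψ 0 ≠ 0) : LinearIndependent ℝ fun i => pderivTwo i X x := by
  rw [Fintype.linearIndependent_iff]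
  intro g hg
  simp only [Fin.sum_univ_two, hX] at hg
  have h1 := congrArg (inner ℝ e) hg
  have h2 := congrArg (inner ℝ f) hg
  simp only [inner_add_right, real_inner_smul_right, hee, hff, hef, real_inner_comm e f,
    inner_zero_right] at h1 h2
  have a : g 0 * (θ 0 * ψ 1 - θ 1 * ψ 0) = 0 := by linear_combination ψ 1 * h1 - θ 1 * h2
  have b : g 1 * (θ 0 * ψ 1 - θ 1 * ψ 0) = 0 := by linear_combination θ 0 * h2 - ψ 0 * h1
  intro i
  fin_cases i
  · exact (mul_eq_zero.1 a).resolve_right hd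
  · exact (mul_eq_zero.1 b).resolve_right hd

/-- The trace with respect to the induced metric, computed in an orthonormal tangent frame. -/
theorem sum_metricInv_coframe (hee : inner ℝ e e = (1 : ℝ)) (hff : inner ℝ f f = (1 : ℝ))
    (hef : inner ℝ e f = (0 : ℝ)) (hX : ∀ i, pderivTwo i X x = θ i • e + ψ i • f)
    (hd : θ 0 * ψ 1 - θ 1 * ψ 0 ≠ 0) :
    ∑ i, ∑ j, metricInv X x i j * (θ i * θ j) = 1 := by
  let Θ : Matrix (Fin 2) (Fin 2) ℝ := !![θ 0, ψ 0; θ 1, ψ 1]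
  have hdet : IsUnit Θ.det := by
    rw [Matrix.det_fin_two_of, mul_comm (ψ 0)]; exact hd.isUnit
  have hdet' : IsUnit Θ.transpose.det := by rwa [Matrix.det_transpose]
  -- From g = ΘΘᵀ follows Θᵀ g⁻¹ Θ = 1; its first diagonal entry is the claim.
  have hg : metric X x = Θ * Θ.transpose := by
    ext i j
    rw [Matrix.mul_apply]
    simp only [metric, Matrix.of_apply, hX, inner_add_left, inner_add_right, real_inner_smul_left,
      real_inner_smul_right, hee, hff, hef, real_inner_comm e f, Fin.sum_univ_two, Θ]
    fin_cases i <;> fin_cases j <;> simp <;> ring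
  have hM : Θ.transpose * metricInv X x * Θ = 1 := by
    rw [metricInv, hg, Matrix.mul_inv_rev, ← mul_assoc, Matrix.mul_nonsing_inv _ hdet', one_mul,
      Matrix.nonsing_inv_mul _ hdet]
  have := congrFun (congrFun hM 0) 0
  simp only [Matrix.mul_apply, Fin.sum_univ_two, Matrix.transpose_apply, Θ] at this
  simp at this
  simp only [Fin.sum_univ_two]
  linear_combination this

end ParamSurface

/-! ### Cylinders over a curve with its Frenet frame -/

/-- `C` is a curve in `ℝ⁴` lying in a hyperplane with unit normal `e`, parametrized by arc length,
with Frenet frame `T, N, B`, constant curvature `k` and nowhere vanishing torsion `τ`. -/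
structure IsFrenetCurve (I : Set ℝ) (C T N B : ℝ → Space4) (τ : ℝ → ℝ) (e : Space4) (k : ℝ) :
    Prop where
  isOpen : IsOpen I
  contDiffOn : ContDiffOn ℝ ∞ C I
  frame : ∀ s ∈ I, IsFrame (T s) e (N s) (B s)
  deriv_curve : ∀ s ∈ I, HasDerivAt C (T s) s
  deriv_tangent : ∀ s ∈ I, HasDerivAt T (k • N s) s
  deriv_normal : ∀ s ∈ I, HasDerivAt N (-k • T s + τ s • B s) s
  torsion_ne_zero : ∀ s ∈ I, τ s ≠ 0

theorem pderivTwo_smul_comp {f u : Plane → ℝ} {G : ℝ → Space4} {G' : Space4} {x : Plane}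
    (hf : DifferentiableAt ℝ f x) (hu : DifferentiableAt ℝ u x) (hG : HasDerivAt G G' (u x))
    (i : Fin 2) :
    pderivTwo i (fun y => f y • G (u y)) x =
      pderivTwo i f x • G (u x) + (f x * pderivTwo i u x) • G' := by
  have := hf.hasFDerivAt.smul (hG.hasFDerivAt.comp x hu.hasFDerivAt)
  simp only [pderivTwo]
  erw [this.fderiv]
  simp [add_comm, mul_smul]

namespace ParamSurface

/-- Here `u` and `v` are arbitrary functions with independent differentials, not the standard
coordinates. The computation therefore applies in every chart of a surface, and no invariance of the
tensors under coordinate changes has to be proved. -/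
theorem cylinder_geometry {I : Set ℝ} {C T N B : ℝ → Space4} {τ : ℝ → ℝ} {e : Space4} {k : ℝ}
    (hC : IsFrenetCurve I C T N B τ e k) {X : Plane → Space4} {u v : Plane → ℝ} {U : Set Plane}
    (hU : IsOpen U) (hu : ContDiffOn ℝ ∞ u U) (hv : ContDiffOn ℝ ∞ v U)
    (huI : ∀ x ∈ U, u x ∈ I)
    (hd : ∀ x ∈ U, pderivTwo 0 u x * pderivTwo 1 v x - pderivTwo 1 u x * pderivTwo 0 v x ≠ 0)
    (hX : ∀ x ∈ U, X x = C (u x) + v x • e) :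
    IsRegularOn X U ∧ (∀ x ∈ U, meanCurvature X x = (k / 2) • N (u x)) ∧
      (∀ x ∈ U, ∀ i, normalDerivMeanCurvature X i x =
        (k / 2 * τ (u x) * pderivTwo i u x) • B (u x)) ∧
      (∀ x ∈ U, ∀ i, divStress X i x = 0) := by
  have hud : ∀ x ∈ U, DifferentiableAt ℝ u x := fun x hx => hu.differentiableAt_of_isOpen hU hx
  have hvd : ∀ x ∈ U, DifferentiableAt ℝ v x := fun x hx => hv.differentiableAt_of_isOpen hU hx
  have hXs : ContDiffOn ℝ ∞ X U :=
    ((hC.contDiffOn.comp hu huI).add (hv.smul contDiffOn_const)).congr hX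
  have hdX : ∀ x ∈ U, ∀ i, pderivTwo i X x = pderivTwo i u x • T (u x) + pderivTwo i v x • e := by
    intro x hx i
    rw [pderivTwo_congr hU (fun y hy => hX y hy) hx]
    have := ((hC.deriv_curve _ (huI x hx)).hasFDerivAt.comp x (hud x hx).hasFDerivAt).add
      ((hvd x hx).hasFDerivAt.smul_const e)
    simp only [pderivTwo]
    erw [this.fderiv]
    simp
  have hreg : IsRegularOn X U := ⟨hU, hXs, fun x hx =>
    linearIndependent_of_coframe (hC.frame _ (huI x hx)).ee (hC.frame _ (huI x hx)).ff
      (hC.frame _ (huI x hx)).ef (hdX x hx) (hd x hx)⟩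
  have hmem : ∀ x ∈ U, T (u x) ∈ tangentPlane X x ∧ e ∈ tangentPlane X x := by
    intro x hx
    have hc := hd x hx
    have h0 := pderivTwo_mem_tangentPlane (X := X) (x := x) 0
    have h1 := pderivTwo_mem_tangentPlane (X := X) (x := x) 1
    rw [hdX x hx] at h0 h1
    constructor
    · refine (Submodule.smul_mem_iff _ hc).1 ?_
      convert! Submodule.sub_mem _ (Submodule.smul_mem _ (pderivTwo 1 v x) h0)
        (Submodule.smul_mem _ (pderivTwo 0 v x) h1) using 1
      module
    · refine (Submodule.smul_mem_iff _ hc).1 ?_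
      convert! Submodule.sub_mem _ (Submodule.smul_mem _ (pderivTwo 0 u x) h1)
        (Submodule.smul_mem _ (pderivTwo 1 u x) h0) using 1
      module
  have hN : ∀ x ∈ U, ∀ i, inner ℝ (N (u x)) (pderivTwo i X x) = 0 := by
    intro x hx i
    have hF := hC.frame _ (huI x hx)
    rw [hdX x hx, inner_add_right, real_inner_smul_right, real_inner_smul_right,
      real_inner_comm (T (u x)), real_inner_comm e, hF.en, hF.fn]
    simp
  have hB : ∀ x ∈ U, ∀ i, inner ℝ (B (u x)) (pderivTwo i X x) = 0 := by
    intro x hx i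
    have hF := hC.frame _ (huI x hx)
    rw [hdX x hx, inner_add_right, real_inner_smul_right, real_inner_smul_right,
      real_inner_comm (T (u x)), real_inner_comm e, hF.em, hF.fm]
    simp
  have hII : ∀ x ∈ U, ∀ i j, secondFundForm X i j x =
      (pderivTwo i u x * pderivTwo j u x * k) • N (u x) := by
    intro x hx i j
    have hdd : pderivTwo i (pderivTwo j X) x =
        (pderivTwo i (pderivTwo j u) x • T (u x) + (pderivTwo j u x * pderivTwo i u x) • k • N (u x))
          + pderivTwo i (pderivTwo j v) x • e := by
      rw [pderivTwo_congr hU (fun y hy => hdX y hy j) hx]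
      have h1 := (hu.pderivTwo hU j).differentiableAt_of_isOpen hU hx
      have h2 := (hv.pderivTwo hU j).differentiableAt_of_isOpen hU hx
      have h3 := hC.deriv_tangent _ (huI x hx)
      rw [← pderivTwo_smul_comp h1 (hud x hx) h3]
      simp only [pderivTwo]
      erw [fderiv_add (h1.smul (h3.differentiableAt.comp x (hud x hx))) (h2.smul_const e),
        fderiv_smul_const h2 e]
      rfl
    apply normalPart_eq
    · intro l
      rw [real_inner_smul_left, hN x hx, mul_zero]
    · rw [hdd]
      convert! Submodule.add_mem _
        (Submodule.smul_mem _ (pderivTwo i (pderivTwo j u) x) (hmem x hx).1)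
        (Submodule.smul_mem _ (pderivTwo i (pderivTwo j v) x) (hmem x hx).2) using 1
      module
  have hH : ∀ x ∈ U, meanCurvature X x = (k / 2) • N (u x) := by
    intro x hx
    have hF := hC.frame _ (huI x hx)
    have := sum_metricInv_coframe hF.ee hF.ff hF.ef (hdX x hx) (hd x hx)
    rw [meanCurvature]
    simp only [hII x hx, smul_smul, ← Finset.sum_smul]
    congr 1
    simp only [Fin.sum_univ_two] at this ⊢
    linear_combination k / 2 * this
  have hD : ∀ x ∈ U, ∀ i, normalDerivMeanCurvature X i x =
      (k / 2 * τ (u x) * pderivTwo i u x) • B (u x) := by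
    intro x hx i
    apply normalPart_eq
    · intro l
      rw [real_inner_smul_left, hB x hx, mul_zero]
    · rw [pderivTwo_congr hU hH hx, pderivTwo_smul_comp (f := fun _ => k / 2)
        (differentiableAt_const _) (hud x hx) (hC.deriv_normal _ (huI x hx))]
      convert! Submodule.smul_mem _ (-(k / 2 * pderivTwo i u x * k)) (hmem x hx).1 using 1
      simp only [pderivTwo, fderiv_fun_const]
      simp
      module
  refine ⟨hreg, hH, hD, fun x hx i => ?_⟩
  have hnorm : ∀ y ∈ U, ‖meanCurvature X y‖ = |k / 2| := by
    intro y hy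
    rw [hH y hy, norm_smul, Real.norm_eq_abs, norm_eq_sqrt_real_inner,
      (hC.frame _ (huI y hy)).nn]
    simp
  rw [hreg.divStress_eq hnorm hx]
  -- The second fundamental form points along `N` and ∇^⊥H along `B`, so every term of the trace is
  -- zero.
  simp [hII x hx, hD x hx, real_inner_smul_left, real_inner_smul_right,
    (hC.frame _ (huI x hx)).nm]

end ParamSurface

/-! ### The adapted frame of a biconservative surface with constant mean curvature -/

namespace ParamSurface

/-- The tangent vector dual to the covector `c`. -/
noncomputable def sharp (X : Plane → Space4) (x : Plane) (c : Fin 2 → ℝ) : Space4 :=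
  ∑ i, ∑ j, (metricInv X x i j * c i) • pderivTwo j X x

section Sharp

variable {X : Plane → Space4} {x : Plane}

theorem sharp_mem_tangentPlane (c : Fin 2 → ℝ) : sharp X x c ∈ tangentPlane X x :=
  Submodule.sum_mem _ fun _ _ => Submodule.sum_mem _ fun j _ =>
    Submodule.smul_mem _ _ (pderivTwo_mem_tangentPlane j)

theorem inner_sharp_pderivTwo (h : LinearIndependent ℝ fun i => pderivTwo i X x) (c : Fin 2 → ℝ)
    (k : Fin 2) : inner ℝ (sharp X x c) (pderivTwo k X x) = c k := by
  have := fun i => sum_metricInv_mul_metric h i k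
  simp only [metric, Matrix.of_apply] at this
  simp only [sharp, sum_inner, real_inner_smul_left, mul_right_comm _ (c _)]
  simp_rw [← Finset.sum_mul, this]
  simp

theorem inner_sharp_self (h : LinearIndependent ℝ fun i => pderivTwo i X x) (c : Fin 2 → ℝ) :
    inner ℝ (sharp X x c) (sharp X x c) = ∑ i, ∑ j, metricInv X x i j * c i * c j := by
  have hk : ∀ k, inner ℝ (pderivTwo k X x) (sharp X x c) = c k := fun k => by
    rw [real_inner_comm, inner_sharp_pderivTwo h]
  conv_lhs => enter [2]; rw [sharp]
  simp only [sum_inner, real_inner_smul_left, hk]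

theorem sharp_ne_zero (h : LinearIndependent ℝ fun i => pderivTwo i X x) {c : Fin 2 → ℝ}
    {k : Fin 2} (hc : c k ≠ 0) : sharp X x c ≠ 0 := by
  intro h0
  apply hc
  rw [← inner_sharp_pderivTwo h c k, h0, inner_zero_left]

/-- A trace-free symmetric bilinear form on the tangent plane with a kernel vanishes. -/
theorem eq_zero_of_trace_eq_zero_of_sharp (h : LinearIndependent ℝ fun i => pderivTwo i X x)
    {β : Fin 2 → Fin 2 → ℝ} (hβ : ∀ i j, β i j = β j i)
    (htr : ∑ i, ∑ j, metricInv X x i j * β i j = 0) {c : Fin 2 → ℝ} {l : Fin 2} (hc : c l ≠ 0)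
    (hker : ∀ k, ∑ i, ∑ j, metricInv X x i j * (c i * β j k) = 0) (i j : Fin 2) :
    β i j = 0 := by
  set a := metricInv X x 0 0 * c 0 + metricInv X x 0 1 * c 1 with ha
  set b := metricInv X x 0 1 * c 0 + metricInv X x 1 1 * c 1 with hb
  have hP : metricInv X x 1 0 = metricInv X x 0 1 := metricInv_symm _ _
  have h10 := hβ 1 0
  simp only [Fin.sum_univ_two, hP, h10] at htr hker
  have k0 : a * β 0 0 + b * β 0 1 = 0 := by
    have := hker 0
    rw [h10] at this
    linear_combination this
  have k1 : a * β 0 1 + b * β 1 1 = 0 := by linear_combination hker 1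
  have hab : b ≠ 0 ∨ a ≠ 0 := by
    by_contra! hcon
    have hz : sharp X x c = a • pderivTwo 0 X x + b • pderivTwo 1 X x := by
      simp only [sharp, Fin.sum_univ_two, hP, ha, hb]
      module
    rw [hcon.1, hcon.2] at hz
    exact sharp_ne_zero h hc (by rw [hz]; simp)
  -- The vector (a, b) dual to `c` is in the kernel of β, so β is a multiple of the square of the
  -- covector (b, -a). Its trace is that multiple times the squared length computed here, which is
  -- positive.
  have hQ : metricInv X x 0 0 * b * b - 2 * metricInv X x 0 1 * a * b +
      metricInv X x 1 1 * a * a ≠ 0 := by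
    have hne : sharp X x ![b, -a] ≠ 0 := by
      rcases hab with hb' | ha'
      · exact sharp_ne_zero h (k := 0) (by simpa using hb')
      · exact sharp_ne_zero h (k := 1) (by simpa using ha')
    have h1 := inner_self_ne_zero (𝕜 := ℝ).2 hne
    rw [inner_sharp_self h] at h1
    simp only [Fin.sum_univ_two, hP, Matrix.cons_val_zero, Matrix.cons_val_one] at h1
    contrapose! h1
    linear_combination h1
  have h00 : β 0 0 = 0 := by
    refine (mul_eq_zero.1 (?_ : _ * β 0 0 = 0)).resolve_left hQ
    linear_combination b ^ 2 * htr + (-2 * metricInv X x 0 1 * b + metricInv X x 1 1 * a) * k0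
      - metricInv X x 1 1 * b * k1
  have h11 : β 1 1 = 0 := by
    refine (mul_eq_zero.1 (?_ : _ * β 1 1 = 0)).resolve_left hQ
    linear_combination a ^ 2 * htr + (-2 * metricInv X x 0 1 * a + metricInv X x 0 0 * b) * k1
      - metricInv X x 0 0 * a * k0
  have h01 : β 0 1 = 0 := by
    rw [h00] at k0
    rw [h11] at k1
    rcases hab with hb' | ha'
    · exact (mul_eq_zero.1 (by linear_combination k0 : b * β 0 1 = 0)).resolve_left hb'
    · exact (mul_eq_zero.1 (by linear_combination k1 : a * β 0 1 = 0)).resolve_left ha'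
  fin_cases i <;> fin_cases j
  · exact h00
  · exact h01
  · exact h10.trans h01
  · exact h11

end Sharp

/-- An orthonormal frame `e, f` (tangent), `n, m` (normal) along `X`, such that the mean curvature
vector is `h n`, the shape operator of `m` vanishes, and the connection form `⟨∂ᵢ n, m⟩` is a
nonzero multiple of `⟨∂ᵢ X, e⟩`. -/
structure IsAdaptedFrame (X : Plane → Space4) (V : Set Plane) (e f n m : Plane → Space4)
    (ρ : Plane → ℝ) (h : ℝ) : Prop where
  regular : IsRegularOn X V
  contDiffOn_e : ContDiffOn ℝ ∞ e V
  contDiffOn_f : ContDiffOn ℝ ∞ f V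
  contDiffOn_n : ContDiffOn ℝ ∞ n V
  contDiffOn_m : ContDiffOn ℝ ∞ m V
  frame : ∀ x ∈ V, IsFrame (e x) (f x) (n x) (m x)
  n_normal : ∀ x ∈ V, ∀ i, inner ℝ (n x) (pderivTwo i X x) = 0
  m_normal : ∀ x ∈ V, ∀ i, inner ℝ (m x) (pderivTwo i X x) = 0
  trace_n : ∀ x ∈ V, ∑ i, ∑ j, metricInv X x i j *
    inner ℝ (n x) (pderivTwo i (pderivTwo j X) x) = 2 * h
  shape_m : ∀ x ∈ V, ∀ i j, inner ℝ (m x) (pderivTwo i (pderivTwo j X) x) = 0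
  ρ_ne_zero : ∀ x ∈ V, ρ x ≠ 0
  connection : ∀ x ∈ V, ∀ i, inner ℝ (m x) (pderivTwo i n x) =
    ρ x * inner ℝ (e x) (pderivTwo i X x)

theorem contDiffOn_inv_norm_smul {w : Plane → Space4} {V : Set Plane} (hw : ContDiffOn ℝ ∞ w V)
    (h0 : ∀ x ∈ V, w x ≠ 0) : ContDiffOn ℝ ∞ (fun x => ‖w x‖⁻¹ • w x) V :=
  ((hw.norm ℝ h0).inv fun x hx => norm_ne_zero_iff.2 (h0 x hx)).smul hw

theorem inner_inv_norm_smul_self {w : Space4} (h0 : w ≠ 0) :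
    inner ℝ (‖w‖⁻¹ • w) (‖w‖⁻¹ • w) = (1 : ℝ) := by
  rw [real_inner_self_eq_norm_sq, norm_smul, norm_inv, norm_norm,
    inv_mul_cancel₀ (norm_ne_zero_iff.2 h0), one_pow]

/-- The normal plane is spanned by H and a derivative ∇^⊥H orthogonal to it. Vanishing divergence
gives A_m a kernel, and m ⊥ H makes its trace zero. -/
theorem exists_isAdaptedFrame {X : Plane → Space4} {U : Set Plane} (hX : IsRegularOn X U)
    (hdiv : ∀ x ∈ U, ∀ k, divStress X k x = 0) {h : ℝ} (h0 : h ≠ 0)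
    (hh : ∀ x ∈ U, ‖meanCurvature X x‖ = h) {x₀ : Plane} (hx₀ : x₀ ∈ U) {i₀ : Fin 2}
    (hD : normalDerivMeanCurvature X i₀ x₀ ≠ 0) :
    ∃ (V : Set Plane) (e f n m : Plane → Space4) (ρ : Plane → ℝ), x₀ ∈ V ∧ V ⊆ U ∧
      IsAdaptedFrame X V e f n m ρ h := by
  let V := U ∩ normalDerivMeanCurvature X i₀ ⁻¹' {0}ᶜ
  have hDs := hX.contDiffOn_normalDerivMeanCurvature
  have hVo : IsOpen V := (hDs i₀).continuousOn.isOpen_inter_preimage hX.isOpen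
    isOpen_compl_singleton
  have hVU : V ⊆ U := Set.inter_subset_left
  have hD0 : ∀ x ∈ V, normalDerivMeanCurvature X i₀ x ≠ 0 := fun x hx => hx.2
  have hXV := hX.mono hVo hVU
  have hHs := hXV.contDiffOn_meanCurvature
  have hHn : ∀ x ∈ V, ‖meanCurvature X x‖ = h := fun x hx => hh x (hVU hx)
  have hli := hXV.linearIndependent
  let n : Plane → Space4 := fun x => h⁻¹ • meanCurvature X x
  let m : Plane → Space4 := fun x =>
    ‖normalDerivMeanCurvature X i₀ x‖⁻¹ • normalDerivMeanCurvature X i₀ x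
  have hns : ContDiffOn ℝ ∞ n V := hHs.const_smul _
  have hms : ContDiffOn ℝ ∞ m V := contDiffOn_inv_norm_smul ((hDs i₀).mono hVU) hD0
  have hHh : ∀ x, meanCurvature X x = h • n x := fun x => by simp [n, smul_smul, h0]
  have hnn : ∀ x ∈ V, inner ℝ (n x) (n x) = 1 := by
    intro x hx
    have := inner_inv_norm_smul_self (norm_ne_zero_iff.1 ((hHn x hx).trans_ne h0))
    rwa [hHn x hx] at this
  have hmm : ∀ x ∈ V, inner ℝ (m x) (m x) = 1 := fun x hx => inner_inv_norm_smul_self (hD0 x hx)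
  have hnt : ∀ x i, inner ℝ (n x) (pderivTwo i X x) = 0 := fun x i => by
    simp [n, real_inner_smul_left, inner_meanCurvature_pderivTwo]
  have hmt : ∀ x i, inner ℝ (m x) (pderivTwo i X x) = 0 := fun x i => by
    simp [m, real_inner_smul_left, normalDerivMeanCurvature, inner_normalPart_pderivTwo]
  have hdH : ∀ x ∈ V, ∀ i, pderivTwo i (meanCurvature X) x = h • pderivTwo i n x := by
    intro x hx i
    rw [show meanCurvature X = fun y => h • n y from funext hHh, pderivTwo,
      fderiv_fun_const_smul (hns.differentiableAt_of_isOpen hVo hx)]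
    rfl
  -- pairing the normal derivative of `H` with normal vectors
  have hDn : ∀ x ∈ V, ∀ i, inner ℝ (n x) (normalDerivMeanCurvature X i x) = 0 := by
    intro x hx i
    rw [real_inner_comm, normalDerivMeanCurvature, inner_normalPart_left _ (hnt x), hdH x hx,
      real_inner_smul_left]
    have := inner_pderivTwo_add_eq_zero hVo hns hns hnn hx i
    rw [real_inner_comm (pderivTwo i n x) (n x)] at this
    rw [(by linarith : inner ℝ (pderivTwo i n x) (n x) = 0), mul_zero]
  have hDm : ∀ x ∈ V, ∀ i, inner ℝ (m x) (normalDerivMeanCurvature X i x) =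
      h * inner ℝ (m x) (pderivTwo i n x) := by
    intro x hx i
    rw [real_inner_comm, normalDerivMeanCurvature, inner_normalPart_left _ (hmt x), hdH x hx,
      real_inner_smul_left, real_inner_comm]
  have hnm : ∀ x ∈ V, inner ℝ (n x) (m x) = 0 := fun x hx => by
    simp only [m, real_inner_smul_right, hDn x hx, mul_zero]
  let α : Plane → Fin 2 → ℝ := fun x i => inner ℝ (m x) (pderivTwo i n x)
  have hαs : ∀ i, ContDiffOn ℝ ∞ (fun x => α x i) V := fun i => hms.inner ℝ (hns.pderivTwo hVo i)
  have hα0 : ∀ x ∈ V, α x i₀ ≠ 0 := by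
    intro x hx hz
    have := hDm x hx i₀
    rw [show inner ℝ (m x) (pderivTwo i₀ n x) = 0 from hz, mul_zero] at this
    simp only [m, real_inner_smul_left, real_inner_self_eq_norm_sq] at this
    simp [hD0 x hx] at this
  let z : Plane → Space4 := fun x => sharp X x (α x)
  have hz0 : ∀ x ∈ V, z x ≠ 0 := fun x hx => sharp_ne_zero (hli x hx) (hα0 x hx)
  have hzs : ContDiffOn ℝ ∞ z V := ContDiffOn.sum fun i _ => ContDiffOn.sum fun j _ =>
    ((hXV.contDiffOn_metricInv i j).mul (hαs i)).smul (hXV.contDiffOn_pderivTwo j)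
  have hzX : ∀ x ∈ V, ∀ i, inner ℝ (z x) (pderivTwo i X x) = α x i := fun x hx i =>
    inner_sharp_pderivTwo (hli x hx) _ i
  -- A tangent vector annihilated by α, hence orthogonal to its dual `z`.
  let w : Plane → Space4 := fun x => (-α x 1) • pderivTwo 0 X x + α x 0 • pderivTwo 1 X x
  have hws : ContDiffOn ℝ ∞ w V := ((hαs 1).neg.smul (hXV.contDiffOn_pderivTwo 0)).add
    ((hαs 0).smul (hXV.contDiffOn_pderivTwo 1))
  have hw0 : ∀ x ∈ V, w x ≠ 0 := by
    intro x hx hz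
    have := Fintype.linearIndependent_iff.1 (hli x hx) ![-α x 1, α x 0]
      (by simpa [Fin.sum_univ_two, w] using hz)
    apply hα0 x hx
    have a := this 0
    have b := this 1
    simp only [Matrix.cons_val_zero, Matrix.cons_val_one, neg_eq_zero] at a b
    fin_cases i₀
    · exact b
    · exact a
  have hzw : ∀ x ∈ V, inner ℝ (z x) (w x) = 0 := by
    intro x hx
    simp only [w, inner_add_right, real_inner_smul_right, hzX x hx]
    ring
  have hnz : ∀ x v, (∀ i, inner ℝ v (pderivTwo i X x) = 0) → inner ℝ (z x) v = 0 := by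
    intro x v hv
    rw [real_inner_comm]
    exact (Submodule.mem_orthogonal' _ _).1 (mem_tangentPlane_orthogonal.2 hv) _
      (sharp_mem_tangentPlane _)
  have hnw : ∀ x v, (∀ i, inner ℝ v (pderivTwo i X x) = 0) → inner ℝ (w x) v = 0 := by
    intro x v hv
    rw [real_inner_comm]
    simp [w, inner_add_right, real_inner_smul_right, hv]
  have hframe : ∀ x ∈ V, IsFrame (‖z x‖⁻¹ • z x) (‖w x‖⁻¹ • w x) (n x) (m x) := by
    intro x hx
    refine ⟨inner_inv_norm_smul_self (hz0 x hx), inner_inv_norm_smul_self (hw0 x hx), hnn x hx,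
      hmm x hx, ?_, ?_, ?_, ?_, ?_, hnm x hx⟩ <;>
    simp only [real_inner_smul_left, real_inner_smul_right, hzw x hx, hnz x _ (hnt x),
      hnz x _ (hmt x), hnw x _ (hnt x), hnw x _ (hmt x), mul_zero]
  have hDα : ∀ x ∈ V, ∀ i, normalDerivMeanCurvature X i x = (h * α x i) • m x := by
    intro x hx i
    have hDt : ∀ k, inner ℝ (normalDerivMeanCurvature X i x) (pderivTwo k X x) = 0 :=
      inner_normalPart_pderivTwo _
    rw [(hframe x hx).eq_sum (normalDerivMeanCurvature X i x), real_inner_smul_left,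
      real_inner_smul_left, hnz x _ hDt, hnw x _ hDt, hDn x hx, hDm x hx]
    simp [α]
  have htr : ∀ x ∈ V, ∀ v, (∀ i, inner ℝ v (pderivTwo i X x) = 0) →
      ∑ i, ∑ j, metricInv X x i j * inner ℝ v (pderivTwo i (pderivTwo j X) x) =
        2 * (h * inner ℝ (n x) v) := by
    intro x hx v hv
    rw [← real_inner_smul_left, ← hHh, two_mul_inner_meanCurvature]
    simp only [inner_secondFundForm hv, real_inner_comm v]
  -- Since ⟨z, ∂ᵢX⟩ = αᵢ and e = z/|z|, the connection form is α = |z| ⟨e, dX⟩; this dictates ρ =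
  -- |z|.
  refine ⟨V, fun x => ‖z x‖⁻¹ • z x, fun x => ‖w x‖⁻¹ • w x, n, m, fun x => ‖z x‖, ⟨hx₀, hD⟩, hVU,
    hXV, contDiffOn_inv_norm_smul hzs hz0, contDiffOn_inv_norm_smul hws hw0, hns, hms, hframe,
    fun x _ => hnt x, fun x _ => hmt x, ?_, ?_, fun x hx => norm_ne_zero_iff.2 (hz0 x hx), ?_⟩
  · intro x hx
    rw [htr x hx _ (hnt x), hnn x hx, mul_one]
  · intro x hx
    refine eq_zero_of_trace_eq_zero_of_sharp (hli x hx) (c := α x) (fun i j => ?_) ?_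
      (hα0 x hx) fun k => ?_
    · rw [pderivTwo_comm hVo hXV.contDiffOn hx]
    · rw [htr x hx _ (hmt x), hnm x hx, mul_zero, mul_zero]
    -- With ∇^⊥H = h α ⊗ m, the divergence is 4h times the contraction of A_m with α.
    · have := hdiv x (hVU hx) k
      rw [hX.divStress_eq hh (hVU hx)] at this
      simp only [hDα x hx, real_inner_smul_right, inner_secondFundForm (hmt x)] at this
      simp only [Fin.sum_univ_two, real_inner_comm (m x)] at this ⊢
      refine (mul_eq_zero.1 (?_ : (4 * h) * _ = 0)).resolve_left (by simpa using h0)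
      linear_combination this
  · intro x hx i
    rw [real_inner_smul_left (z x), hzX x hx, mul_inv_cancel_left₀ (norm_ne_zero_iff.2 (hz0 x hx))]

end ParamSurface

/-! ### The structure equations -/

namespace ParamSurface.IsAdaptedFrame

variable {X : Plane → Space4} {V : Set Plane} {e f n m : Plane → Space4} {ρ : Plane → ℝ} {h : ℝ}
  (hF : IsAdaptedFrame X V e f n m ρ h) {x : Plane} (hx : x ∈ V)
include hF hx

theorem pderivTwo_eq (i : Fin 2) :
    pderivTwo i X x =
      inner ℝ (e x) (pderivTwo i X x) • e x + inner ℝ (f x) (pderivTwo i X x) • f x := by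
  conv_lhs => rw [(hF.frame x hx).eq_sum (pderivTwo i X x), hF.n_normal x hx, hF.m_normal x hx]
  simp

theorem det_ne_zero :
    inner ℝ (e x) (pderivTwo 0 X x) * inner ℝ (f x) (pderivTwo 1 X x) -
      inner ℝ (e x) (pderivTwo 1 X x) * inner ℝ (f x) (pderivTwo 0 X x) ≠ 0 :=
  det_coframe_ne_zero (θ := fun i => inner ℝ (e x) (pderivTwo i X x))
    (ψ := fun i => inner ℝ (f x) (pderivTwo i X x)) (hF.regular.linearIndependent x hx)
    (hF.pderivTwo_eq hx)

/-- A covector vanishing on the tangent plane, written in the frame. -/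
theorem eq_zero_of_forall {p q : ℝ} (h0 : ∀ j, p * inner ℝ (e x) (pderivTwo j X x) +
    q * inner ℝ (f x) (pderivTwo j X x) = 0) : p = 0 ∧ q = 0 := by
  have hd := hF.det_ne_zero hx
  have a := h0 0
  have b := h0 1
  constructor
  · refine (mul_eq_zero.1 (?_ : p * _ = 0)).resolve_right hd
    linear_combination inner ℝ (f x) (pderivTwo 1 X x) * a - inner ℝ (f x) (pderivTwo 0 X x) * b
  · refine (mul_eq_zero.1 (?_ : q * _ = 0)).resolve_right hd
    linear_combination inner ℝ (e x) (pderivTwo 0 X x) * b - inner ℝ (e x) (pderivTwo 1 X x) * a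

/-- A covector whose wedge products with both members of a coframe vanish is zero. -/
theorem eq_zero_of_symm {a : Fin 2 → ℝ}
    (h1 : inner ℝ (e x) (pderivTwo 0 X x) * a 1 = inner ℝ (e x) (pderivTwo 1 X x) * a 0)
    (h2 : inner ℝ (f x) (pderivTwo 0 X x) * a 1 = inner ℝ (f x) (pderivTwo 1 X x) * a 0)
    (i : Fin 2) : a i = 0 := by
  have hd := hF.det_ne_zero hx
  fin_cases i
  · refine (mul_eq_zero.1 (?_ : a 0 * _ = 0)).resolve_right hd
    linear_combination inner ℝ (f x) (pderivTwo 0 X x) * h1 - inner ℝ (e x) (pderivTwo 0 X x) * h2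
  · refine (mul_eq_zero.1 (?_ : a 1 * _ = 0)).resolve_right hd
    linear_combination inner ℝ (f x) (pderivTwo 1 X x) * h1 - inner ℝ (e x) (pderivTwo 1 X x) * h2

theorem inner_pderivTwo_of_const {F G : Plane → Space4} (hFs : ContDiffOn ℝ ∞ F V)
    (hGs : ContDiffOn ℝ ∞ G V) {c : ℝ} (hc : ∀ y ∈ V, inner ℝ (F y) (G y) = c) (i : Fin 2) :
    inner ℝ (F x) (pderivTwo i G x) = -inner ℝ (G x) (pderivTwo i F x) := by
  have := inner_pderivTwo_add_eq_zero hF.regular.isOpen hFs hGs hc hx i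
  rw [real_inner_comm] at this
  linarith

theorem inner_pderivTwo_self {F : Plane → Space4} (hFs : ContDiffOn ℝ ∞ F V) {c : ℝ}
    (hc : ∀ y ∈ V, inner ℝ (F y) (F y) = c) (i : Fin 2) :
    inner ℝ (F x) (pderivTwo i F x) = 0 := by
  have := hF.inner_pderivTwo_of_const hx hFs hFs hc i
  linarith

/-- The tangential part of dm is minus the shape operator of m, which vanishes. -/
theorem inner_pderivTwo_m (i : Fin 2) :
    inner ℝ (e x) (pderivTwo i m x) = 0 ∧ inner ℝ (f x) (pderivTwo i m x) = 0 := by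
  refine hF.eq_zero_of_forall hx fun j => ?_
  have h1 := hF.inner_pderivTwo_of_const hx hF.contDiffOn_m (hF.regular.contDiffOn_pderivTwo j)
    (fun y hy => hF.m_normal y hy j) i
  rw [hF.shape_m x hx, hF.pderivTwo_eq hx j, inner_add_left, real_inner_smul_left,
    real_inner_smul_left] at h1
  linarith

theorem inner_n_pderivTwo_m (i : Fin 2) :
    inner ℝ (n x) (pderivTwo i m x) = -(ρ x * inner ℝ (e x) (pderivTwo i X x)) := by
  rw [hF.inner_pderivTwo_of_const hx hF.contDiffOn_n hF.contDiffOn_m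
    (fun y hy => (hF.frame y hy).nm), hF.connection x hx]

/-- As ∂ᵢm is -ρ θᵢ n, pairing ∂ⱼ∂ᵢm with ∂ₖX gives ρ θᵢ ⟨n, ∂ⱼ∂ₖX⟩. Second derivatives of m commute
and ρ ≠ 0 cancels. -/
theorem codazzi (i j k : Fin 2) :
    inner ℝ (e x) (pderivTwo i X x) * inner ℝ (n x) (pderivTwo j (pderivTwo k X) x) =
      inner ℝ (e x) (pderivTwo j X x) * inner ℝ (n x) (pderivTwo i (pderivTwo k X) x) := by
  have key : ∀ i j, inner ℝ (pderivTwo k X x) (pderivTwo j (pderivTwo i m) x) =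
      ρ x * inner ℝ (e x) (pderivTwo i X x) *
        inner ℝ (n x) (pderivTwo j (pderivTwo k X) x) := by
    intro i j
    have h1 := hF.inner_pderivTwo_of_const hx (hF.regular.contDiffOn_pderivTwo k)
      (hF.contDiffOn_m.pderivTwo hF.regular.isOpen i) (c := 0) (fun y hy => by
        rw [hF.inner_pderivTwo_of_const hy (hF.regular.contDiffOn_pderivTwo k) hF.contDiffOn_m
          (fun w hw => by rw [real_inner_comm, hF.m_normal w hw]), hF.shape_m y hy, neg_zero]) j
    rw [h1, (hF.frame x hx).inner_eq, (hF.inner_pderivTwo_m hx i).1, (hF.inner_pderivTwo_m hx i).2,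
      hF.inner_n_pderivTwo_m hx, hF.shape_m x hx]
    ring
  have h2 := key i j
  rw [pderivTwo_comm hF.regular.isOpen hF.contDiffOn_m hx, key j i] at h2
  refine mul_left_cancel₀ (hF.ρ_ne_zero x hx) ?_
  linear_combination -h2

/-- The Codazzi relation makes the symmetric form A_n a multiple of θ ⊗ θ, and |θ| = 1 identifies
the multiple with the trace 2h. -/
theorem inner_n_pderivTwo_pderivTwo (i j : Fin 2) :
    inner ℝ (n x) (pderivTwo i (pderivTwo j X) x) =
      2 * h * (inner ℝ (e x) (pderivTwo i X x) * inner ℝ (e x) (pderivTwo j X x)) := by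
  obtain ⟨l, hl⟩ : ∃ l, inner ℝ (e x) (pderivTwo l X x) ≠ 0 := by
    by_contra! hcon
    apply hF.det_ne_zero hx
    rw [hcon, hcon]
    ring
  set θ : Fin 2 → ℝ := fun i => inner ℝ (e x) (pderivTwo i X x) with hθ
  have hc := fun i j k => hF.codazzi hx i j k
  have hs : ∀ i j, inner ℝ (n x) (pderivTwo i (pderivTwo j X) x) =
      inner ℝ (n x) (pderivTwo j (pderivTwo i X) x) := fun i j => by
    rw [pderivTwo_comm hF.regular.isOpen hF.regular.contDiffOn hx]
  set μ := inner ℝ (n x) (pderivTwo l (pderivTwo l X) x) / θ l ^ 2 with hμ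
  have hb : ∀ i j, inner ℝ (n x) (pderivTwo i (pderivTwo j X) x) = μ * (θ i * θ j) := by
    intro i j
    have h1 := hc l i j
    have h2 := hc l j l
    rw [hs l j] at h1
    change θ l * _ = θ i * _ at h1
    change θ l * _ = θ j * _ at h2
    rw [hμ]
    have hl' : θ l ≠ 0 := hl
    field_simp
    linear_combination θ l * h1 + θ i * h2
  have htr := hF.trace_n x hx
  have hfr := hF.frame x hx
  have h1 := sum_metricInv_coframe hfr.ee hfr.ff hfr.ef (hF.pderivTwo_eq hx) (hF.det_ne_zero hx)
  have hμh : μ = 2 * h := by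
    simp only [hb] at htr
    change ∑ i, ∑ j, metricInv X x i j * (θ i * θ j) = 1 at h1
    simp only [Fin.sum_univ_two] at h1 htr
    linear_combination htr - μ * h1
  rw [hb, hμh]

theorem inner_pderivTwo_n (i : Fin 2) :
    inner ℝ (e x) (pderivTwo i n x) = -(2 * h * inner ℝ (e x) (pderivTwo i X x)) ∧
      inner ℝ (f x) (pderivTwo i n x) = 0 := by
  have := hF.eq_zero_of_forall hx
    (p := inner ℝ (e x) (pderivTwo i n x) + 2 * h * inner ℝ (e x) (pderivTwo i X x))
    (q := inner ℝ (f x) (pderivTwo i n x)) fun j => by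
    have h1 := hF.inner_pderivTwo_of_const hx hF.contDiffOn_n (hF.regular.contDiffOn_pderivTwo j)
      (fun y hy => hF.n_normal y hy j) i
    rw [hF.inner_n_pderivTwo_pderivTwo hx] at h1
    conv_rhs at h1 => rw [hF.pderivTwo_eq hx j]
    rw [inner_add_left, real_inner_smul_left, real_inner_smul_left] at h1
    linarith
  exact ⟨eq_neg_of_add_eq_zero_left this.1, this.2⟩

theorem inner_m_pderivTwo (i : Fin 2) :
    inner ℝ (m x) (pderivTwo i e x) = 0 ∧ inner ℝ (m x) (pderivTwo i f x) = 0 := by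
  rw [hF.inner_pderivTwo_of_const hx hF.contDiffOn_m hF.contDiffOn_e
    (fun y hy => by rw [real_inner_comm, (hF.frame y hy).em]),
    hF.inner_pderivTwo_of_const hx hF.contDiffOn_m hF.contDiffOn_f
    (fun y hy => by rw [real_inner_comm, (hF.frame y hy).fm]), (hF.inner_pderivTwo_m hx i).1,
    (hF.inner_pderivTwo_m hx i).2]
  simp

/-- Write ω = ⟨e, df⟩ and ψ = ⟨f, dX⟩. Commuting second derivatives of n, read along f, give θ ∧ ω =
0; read along e, together with those of X, they give ψ ∧ ω = 0. Division by 2h needs h ≠ 0. -/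
theorem inner_e_pderivTwo_f (h0 : h ≠ 0) (i : Fin 2) : inner ℝ (e x) (pderivTwo i f x) = 0 := by
  have hfr := hF.frame x hx
  have hn2 : ∀ i j, inner ℝ (pderivTwo i n x) (pderivTwo j f x) =
      -(2 * h * (inner ℝ (e x) (pderivTwo i X x) * inner ℝ (e x) (pderivTwo j f x))) := by
    intro i j
    rw [hfr.inner_eq, (hF.inner_pderivTwo_n hx i).1, (hF.inner_pderivTwo_n hx i).2,
      hF.inner_pderivTwo_self hx hF.contDiffOn_n (fun y hy => (hF.frame y hy).nn),
      (hF.inner_m_pderivTwo hx j).2]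
    ring
  have hn1 : ∀ i j, inner ℝ (pderivTwo i n x) (pderivTwo j e x) = 0 := by
    intro i j
    rw [hfr.inner_eq, (hF.inner_pderivTwo_n hx i).2,
      hF.inner_pderivTwo_self hx hF.contDiffOn_n (fun y hy => (hF.frame y hy).nn),
      (hF.inner_m_pderivTwo hx j).1,
      hF.inner_pderivTwo_self hx hF.contDiffOn_e (fun y hy => (hF.frame y hy).ee)]
    ring
  have hX1 : ∀ i j, inner ℝ (pderivTwo i X x) (pderivTwo j e x) =
      -(inner ℝ (f x) (pderivTwo i X x) * inner ℝ (e x) (pderivTwo j f x)) := by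
    intro i j
    conv_lhs => rw [hF.pderivTwo_eq hx i]
    rw [inner_add_left, real_inner_smul_left, real_inner_smul_left,
      hF.inner_pderivTwo_self hx hF.contDiffOn_e (fun y hy => (hF.frame y hy).ee),
      hF.inner_pderivTwo_of_const hx hF.contDiffOn_f hF.contDiffOn_e
        (fun y hy => by rw [real_inner_comm, (hF.frame y hy).ef])]
    ring
  have hns := fun i => hF.contDiffOn_n.pderivTwo hF.regular.isOpen i
  have hXs := fun i => hF.regular.contDiffOn_pderivTwo i
  have hf2 : ∀ i j, inner ℝ (f x) (pderivTwo j (pderivTwo i n) x) =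
      2 * h * (inner ℝ (e x) (pderivTwo i X x) * inner ℝ (e x) (pderivTwo j f x)) := by
    intro i j
    rw [hF.inner_pderivTwo_of_const hx hF.contDiffOn_f (hns i)
      (fun y hy => (hF.inner_pderivTwo_n hy i).2), hn2, neg_neg]
  -- The combination ∂ᵢn + 2h ∂ᵢX has no component along e, so derivatives of θ never enter.
  have he2 : ∀ i j, inner ℝ (e x) (pderivTwo j (pderivTwo i n) x) +
      2 * h * inner ℝ (e x) (pderivTwo j (pderivTwo i X) x) =
      2 * h * (inner ℝ (f x) (pderivTwo i X x) * inner ℝ (e x) (pderivTwo j f x)) := by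
    intro i j
    have hG : ContDiffOn ℝ ∞ (fun y => pderivTwo i n y + (2 * h) • pderivTwo i X y) V :=
      (hns i).add ((hXs i).const_smul (2 * h))
    have h1 := hF.inner_pderivTwo_of_const hx hF.contDiffOn_e hG (c := 0) (fun y hy => by
      rw [inner_add_right, real_inner_smul_right, (hF.inner_pderivTwo_n hy i).1]
      ring) j
    have h2 : pderivTwo j (fun y => pderivTwo i n y + (2 * h) • pderivTwo i X y) x =
        pderivTwo j (pderivTwo i n) x + (2 * h) • pderivTwo j (pderivTwo i X) x := by
      have a := (hns i).differentiableAt_of_isOpen hF.regular.isOpen hx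
      have b := (hXs i).differentiableAt_of_isOpen hF.regular.isOpen hx
      rw [pderivTwo, fderiv_fun_add a (b.fun_const_smul _), fderiv_fun_const_smul b]
      rfl
    rw [h2, inner_add_right, inner_add_left, real_inner_smul_left, real_inner_smul_right, hn1,
      hX1] at h1
    linarith
  have hc1 := pderivTwo_comm hF.regular.isOpen hF.contDiffOn_n hx 1 0
  have hc2 := pderivTwo_comm hF.regular.isOpen hF.regular.contDiffOn hx 1 0
  refine hF.eq_zero_of_symm hx (a := fun i => inner ℝ (e x) (pderivTwo i f x)) ?_ ?_ i
  · refine mul_left_cancel₀ (mul_ne_zero two_ne_zero h0) ?_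
    rw [← hf2, ← hf2, hc1]
  · refine mul_left_cancel₀ (mul_ne_zero two_ne_zero h0) ?_
    rw [← he2, ← he2, hc1, hc2]

/-- All four frame components of df vanish: f is the fixed direction of the rulings. -/
theorem pderivTwo_f (h0 : h ≠ 0) (i : Fin 2) : pderivTwo i f x = 0 := by
  refine (hF.frame x hx).eq_zero (hF.inner_e_pderivTwo_f hx h0 i)
    (hF.inner_pderivTwo_self hx hF.contDiffOn_f (fun y hy => (hF.frame y hy).ff) i) ?_
    (hF.inner_m_pderivTwo hx i).2
  rw [hF.inner_pderivTwo_of_const hx hF.contDiffOn_n hF.contDiffOn_f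
    (fun y hy => by rw [real_inner_comm, (hF.frame y hy).fn]), (hF.inner_pderivTwo_n hx i).2,
    neg_zero]

theorem pderivTwo_e (h0 : h ≠ 0) (i : Fin 2) :
    pderivTwo i e x = inner ℝ (e x) (pderivTwo i X x) • (2 * h) • n x := by
  rw [(hF.frame x hx).eq_sum (pderivTwo i e x),
    hF.inner_pderivTwo_self hx hF.contDiffOn_e (fun y hy => (hF.frame y hy).ee),
    hF.inner_pderivTwo_of_const hx hF.contDiffOn_f hF.contDiffOn_e
      (fun y hy => by rw [real_inner_comm, (hF.frame y hy).ef]), hF.inner_e_pderivTwo_f hx h0,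
    hF.inner_pderivTwo_of_const hx hF.contDiffOn_n hF.contDiffOn_e
      (fun y hy => by rw [real_inner_comm, (hF.frame y hy).en]), (hF.inner_pderivTwo_n hx i).1,
    (hF.inner_m_pderivTwo hx i).1]
  module

theorem pderivTwo_n (i : Fin 2) :
    pderivTwo i n x = inner ℝ (e x) (pderivTwo i X x) • (-(2 * h) • e x + ρ x • m x) := by
  rw [(hF.frame x hx).eq_sum (pderivTwo i n x), (hF.inner_pderivTwo_n hx i).1,
    (hF.inner_pderivTwo_n hx i).2,
    hF.inner_pderivTwo_self hx hF.contDiffOn_n (fun y hy => (hF.frame y hy).nn),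
    hF.connection x hx]
  module

end ParamSurface.IsAdaptedFrame

/-! ### Flattening coordinates -/

/-- A closed `1`-form on a convex open subset of the plane is exact. -/
theorem exists_contDiffOn_pderivTwo_eq {V : Set Plane} (hV : IsOpen V) (hc : Convex ℝ V)
    {a : Fin 2 → Plane → ℝ} (ha : ∀ i, ContDiffOn ℝ ∞ (a i) V)
    (hcl : ∀ x ∈ V, pderivTwo 0 (a 1) x = pderivTwo 1 (a 0) x) :
    ∃ u : Plane → ℝ, ContDiffOn ℝ ∞ u V ∧ ∀ x ∈ V, ∀ i, pderivTwo i u x = a i x := by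
  let α : Plane → Plane →L[ℝ] ℝ := fun x => ∑ i, a i x • (EuclideanSpace.proj i : Plane →L[ℝ] ℝ)
  have hα : ContDiffOn ℝ ∞ α V := ContDiffOn.sum fun i _ => (ha i).smul contDiffOn_const
  have hd : ∀ x ∈ V, ∀ v w, fderiv ℝ α x v w = ∑ i, fderiv ℝ (a i) x v * w i := by
    intro x hx v w
    have h1 : HasFDerivAt α (∑ i, (fderiv ℝ (a i) x).smulRight
        (EuclideanSpace.proj i : Plane →L[ℝ] ℝ)) x :=
      HasFDerivAt.fun_sum fun i _ => HasFDerivAt.smul_const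
        ((ha i).differentiableAt_of_isOpen hV hx).hasFDerivAt
        (EuclideanSpace.proj i : Plane →L[ℝ] ℝ)
    rw [h1.fderiv]
    simp
  obtain ⟨u, hu⟩ := hc.exists_forall_hasFDerivAt_of_fderiv_symmetric hV
    (fun x hx => (hα.differentiableAt_of_isOpen hV hx).differentiableWithinAt) fun x hx v w => by
      have := hcl x hx
      rw [hd x hx, hd x hx]
      simp only [fderiv_eq_sum_pderivTwo, Fin.sum_univ_two, smul_eq_mul]
      linear_combination (v 0 * w 1 - v 1 * w 0) * this
  refine ⟨u, ?_, fun x hx i => ?_⟩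
  · rw [contDiffOn_infty_iff_fderiv_of_isOpen hV]
    exact ⟨fun x hx => (hu x hx).differentiableAt.differentiableWithinAt,
      hα.congr fun x hx => (hu x hx).fderiv⟩
  · rw [pderivTwo, (hu x hx).fderiv]
    fin_cases i <;> simp [α]

/-- Two functions with independent differentials at every point of a neighbourhood of `x₀` are the
coordinates of a smooth chart with values in an open rectangle. -/
theorem exists_chart_of_pderivTwo {V : Set Plane} (hV : IsOpen V) {u v : Plane → ℝ}
    (hu : ContDiffOn ℝ ∞ u V) (hv : ContDiffOn ℝ ∞ v V)
    (hd : ∀ x ∈ V, pderivTwo 0 u x * pderivTwo 1 v x - pderivTwo 1 u x * pderivTwo 0 v x ≠ 0)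
    {x₀ : Plane} (hx₀ : x₀ ∈ V) :
    ∃ (τ : OpenPartialHomeomorph Plane Plane) (ε : ℝ), 0 < ε ∧ x₀ ∈ τ.source ∧ τ.source ⊆ V ∧
      ContDiffOn ℝ ∞ τ τ.source ∧ ContDiffOn ℝ ∞ τ.symm τ.target ∧
      τ.target = {y | y 0 ∈ Set.Ioo (u x₀ - ε) (u x₀ + ε) ∧ y 1 ∈ Set.Ioo (v x₀ - ε) (v x₀ + ε)} ∧
      ∀ x, τ x = !₂[u x, v x] := by
  let G : Plane → Plane := fun x => !₂[u x, v x]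
  have hG : ContDiffOn ℝ ∞ G V := by
    rw [contDiffOn_euclidean]
    intro i
    fin_cases i
    · exact hu
    · exact hv
  have hGd : ∀ x ∈ V, ∃ A : Plane ≃L[ℝ] Plane, HasFDerivAt G (A : Plane →L[ℝ] Plane) x := by
    intro x hx
    have h1 := (hG.differentiableAt_of_isOpen hV hx).hasFDerivAt
    have hcomp : ∀ w, (fderiv ℝ G x w) 0 = fderiv ℝ u x w ∧ (fderiv ℝ G x w) 1 = fderiv ℝ v x w := by
      intro w
      have h2 : ∀ i, HasFDerivAt (fun y => G y i)
          ((EuclideanSpace.proj i : Plane →L[ℝ] ℝ).comp (fderiv ℝ G x)) x := fun i =>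
        (EuclideanSpace.proj i : Plane →L[ℝ] ℝ).hasFDerivAt.comp x h1
      have h3 : fderiv ℝ u x = _ := (h2 0).fderiv
      have h4 : fderiv ℝ v x = _ := (h2 1).fderiv
      rw [h3, h4]
      exact ⟨rfl, rfl⟩
    have hinj : Function.Injective (fderiv ℝ G x).toLinearMap := by
      rw [← LinearMap.ker_eq_bot, LinearMap.ker_eq_bot']
      intro w hw
      have hw' : fderiv ℝ G x w = 0 := hw
      have h2 := (hcomp w).1
      have h3 := (hcomp w).2
      rw [hw', fderiv_eq_sum_pderivTwo] at h2 h3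
      simp only [Fin.sum_univ_two, smul_eq_mul, PiLp.zero_apply] at h2 h3
      ext i
      refine (mul_eq_zero.1 (?_ : w i * _ = 0)).resolve_right (hd x hx)
      fin_cases i
      · simp only [Fin.zero_eta]
        linear_combination pderivTwo 1 u x * h3 - pderivTwo 1 v x * h2
      · simp only [Fin.mk_one]
        linear_combination pderivTwo 0 v x * h2 - pderivTwo 0 u x * h3
    refine ⟨(LinearEquiv.ofInjectiveEndo _ hinj).toContinuousLinearEquiv, ?_⟩
    convert! h1 using 1
  obtain ⟨A, hA⟩ := hGd x₀ hx₀
  have hGx := hG.contDiffAt (hV.mem_nhds hx₀)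
  let τ₀ := hGx.toOpenPartialHomeomorph G hA (by simp)
  have hτ₀ : ∀ x, τ₀ x = G x := fun x => rfl
  have hx₀s : x₀ ∈ τ₀.source := hGx.mem_toOpenPartialHomeomorph_source hA (by simp)
  let τ₁ := τ₀.restrOpen V hV
  have hτ₁ : ∀ x, τ₁ x = G x := fun x => rfl
  have hτ₁s : τ₁.source = τ₀.source ∩ V := τ₀.restrOpen_source V hV
  have hx₁ : x₀ ∈ τ₁.source := hτ₁s ▸ ⟨hx₀s, hx₀⟩
  obtain ⟨ε, hε, hball⟩ : ∃ ε > 0, {y : Plane | y 0 ∈ Set.Ioo (u x₀ - ε) (u x₀ + ε) ∧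
      y 1 ∈ Set.Ioo (v x₀ - ε) (v x₀ + ε)} ⊆ τ₁.target := by
    have h1 : τ₁.target ∈ nhds (G x₀) := τ₁.open_target.mem_nhds (τ₁.map_source hx₁)
    obtain ⟨δ, hδ, hb⟩ := Metric.mem_nhds_iff.1 h1
    -- A square of half-side δ/2 fits in the disc of radius δ because 2(δ/2)² < δ².
    refine ⟨δ / 2, half_pos hδ, fun y hy => hb ?_⟩
    obtain ⟨⟨h2, h3⟩, h4, h5⟩ := hy
    rw [Metric.mem_ball, EuclideanSpace.dist_eq, Real.sqrt_lt' hδ, Fin.sum_univ_two]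
    have h6 : dist (y 0) (G x₀ 0) ^ 2 < (δ / 2) ^ 2 := by
      rw [Real.dist_eq, sq_abs]
      exact sq_lt_sq' (by change _ < y 0 - u x₀; linarith) (by change y 0 - u x₀ < _; linarith)
    have h7 : dist (y 1) (G x₀ 1) ^ 2 < (δ / 2) ^ 2 := by
      rw [Real.dist_eq, sq_abs]
      exact sq_lt_sq' (by change _ < y 1 - v x₀; linarith) (by change y 1 - v x₀ < _; linarith)
    nlinarith
  set R := {y : Plane | y 0 ∈ Set.Ioo (u x₀ - ε) (u x₀ + ε) ∧
      y 1 ∈ Set.Ioo (v x₀ - ε) (v x₀ + ε)} with hR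
  have hRo : IsOpen R :=
    (isOpen_Ioo.preimage (EuclideanSpace.proj (0 : Fin 2) : Plane →L[ℝ] ℝ).continuous).inter
      (isOpen_Ioo.preimage (EuclideanSpace.proj (1 : Fin 2) : Plane →L[ℝ] ℝ).continuous)
  -- Restricting the inverse, rather than the map, makes the target exactly the rectangle.
  let τ := (τ₁.symm.restrOpen R hRo).symm
  have hτt : τ.target = R := by
    change (τ₁.symm.restrOpen R hRo).source = R
    rw [OpenPartialHomeomorph.restrOpen_source]
    exact Set.inter_eq_right.2 hball
  have hτ : ∀ x, τ x = G x := fun x => rfl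
  have hsV : τ.source ⊆ V := by
    intro x hx
    have h2 : τ.symm (τ x) ∈ τ₁.source := τ₁.map_target (hball (hτt ▸ τ.map_source hx))
    rw [τ.left_inv hx, hτ₁s] at h2
    exact h2.2
  refine ⟨τ, ε, hε, ?_, hsV, hG.mono hsV, ?_, hτt, hτ⟩
  · have h2 : τ₁.symm (G x₀) = x₀ := τ₁.left_inv hx₁
    have h3 : τ.symm (G x₀) ∈ τ.source := τ.map_target (by
      rw [hτt]
      exact ⟨⟨sub_lt_self _ hε, lt_add_of_pos_right _ hε⟩,
        ⟨sub_lt_self _ hε, lt_add_of_pos_right _ hε⟩⟩)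
    rwa [show τ.symm (G x₀) = x₀ from h2] at h3
  · intro y hy
    have hs := hsV (τ.map_target hy)
    obtain ⟨A, hA⟩ := hGd _ hs
    exact (τ.contDiffAt_symm hy hA (hG.contDiffAt (hV.mem_nhds hs))).contDiffWithinAt

namespace ParamSurface.IsAdaptedFrame

variable {X : Plane → Space4} {V : Set Plane} {e f n m : Plane → Space4} {ρ : Plane → ℝ} {h : ℝ}

/-- The differentials of e, n and X - v f are multiples of θ = du, so along a line v = const they
satisfy the Frenet equations with parameter u. -/
theorem exists_cylinder_chart (hF : IsAdaptedFrame X V e f n m ρ h) (h0 : h ≠ 0) {x₀ : Plane}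
    (hx₀ : x₀ ∈ V) :
    ∃ (τ : OpenPartialHomeomorph Plane Plane) (I J : Set ℝ) (C T N B : ℝ → Space4) (t : ℝ → ℝ)
      (e₀ : Space4), x₀ ∈ τ.source ∧ τ.source ⊆ V ∧ ContDiffOn ℝ ∞ τ τ.source ∧
      ContDiffOn ℝ ∞ τ.symm τ.target ∧ I.OrdConnected ∧ IsOpen J ∧ J.OrdConnected ∧ I.Nonempty ∧
      τ.target = {y | y 0 ∈ I ∧ y 1 ∈ J} ∧ IsFrenetCurve I C T N B t e₀ (2 * h) ∧
      (∀ s ∈ I, inner ℝ (C s) e₀ = 0) ∧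
      ∀ y ∈ τ.target, X (τ.symm y) = C (y 0) + y 1 • e₀ := by
  obtain ⟨r, hr, hball⟩ := Metric.isOpen_iff.1 hF.regular.isOpen x₀ hx₀
  set W := Metric.ball x₀ r with hW
  have hWo : IsOpen W := Metric.isOpen_ball
  have hWc : Convex ℝ W := convex_ball x₀ r
  have hx₀W : x₀ ∈ W := Metric.mem_ball_self hr
  -- `f` is constant
  set e₀ := f x₀ with he₀
  have hfd : ∀ x ∈ W, HasFDerivAt f (0 : Plane →L[ℝ] Space4) x := by
    intro x hx
    have h1 := ((hF.contDiffOn_f.differentiableAt_of_isOpen hF.regular.isOpen (hball hx))).hasFDerivAt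
    convert! h1 using 1
    ext1 w
    rw [fderiv_eq_sum_pderivTwo]
    simp [hF.pderivTwo_f (hball hx) h0]
  have hf : ∀ x ∈ W, f x = e₀ := fun x hx =>
    hWo.is_const_of_fderiv_eq_zero hWc.isPreconnected
      (fun y hy => (hfd y hy).differentiableAt.differentiableWithinAt)
      (fun y hy => (hfd y hy).fderiv) hx hx₀W
  -- the coordinates
  have hXs := fun i => (hF.regular.contDiffOn_pderivTwo i).mono hball
  have hes := hF.contDiffOn_e.mono hball
  have hXo := hF.regular.contDiffOn.mono hball
  -- The form θ = ⟨e, dX⟩ is closed: de is a multiple of n, which is orthogonal to dX. Passing to a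
  -- ball supplies the convexity needed for a primitive.
  obtain ⟨u, hu, hdu⟩ := exists_contDiffOn_pderivTwo_eq hWo hWc
    (a := fun i x => inner ℝ (e x) (pderivTwo i X x)) (fun i => hes.inner ℝ (hXs i)) (by
      intro x hx
      have hV := hball hx
      have h1 := hes.differentiableAt_of_isOpen hWo hx
      have h2 := fun i => (hXs i).differentiableAt_of_isOpen hWo hx
      rw [pderivTwo_inner h1 (h2 1), pderivTwo_inner h1 (h2 0), hF.pderivTwo_e hV h0,
        hF.pderivTwo_e hV h0, pderivTwo_comm hWo hXo hx]
      simp [real_inner_smul_left, hF.n_normal x hV])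
  let v : Plane → ℝ := fun x => inner ℝ e₀ (X x)
  have hv : ContDiffOn ℝ ∞ v W := contDiffOn_const.inner ℝ hXo
  have hdv : ∀ x ∈ W, ∀ i, pderivTwo i v x = inner ℝ (f x) (pderivTwo i X x) := by
    intro x hx i
    rw [pderivTwo_inner (differentiableAt_const _) (hXo.differentiableAt_of_isOpen hWo hx), hf x hx]
    simp [pderivTwo]
  obtain ⟨τ, ε, hε, hxτ, hτW, hτs, hτss, hτt, hτ⟩ := exists_chart_of_pderivTwo hWo hu hv
    (fun x hx => by
      rw [hdu x hx, hdu x hx, hdv x hx, hdv x hx]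
      exact hF.det_ne_zero (hball hx)) hx₀W
  set I := Set.Ioo (u x₀ - ε) (u x₀ + ε) with hI
  set J := Set.Ioo (v x₀ - ε) (v x₀ + ε) with hJ
  have hvJ : v x₀ ∈ J := ⟨sub_lt_self _ hε, lt_add_of_pos_right _ hε⟩
  have hmem : ∀ y ∈ τ.target, τ.symm y ∈ W := fun y hy => hτW (τ.map_target hy)
  have hinv : ∀ y ∈ τ.target, u (τ.symm y) = y 0 ∧ v (τ.symm y) = y 1 := by
    intro y hy
    have h1 := τ.right_inv hy
    rw [hτ] at h1
    exact ⟨congrArg (fun w : Plane => w 0) h1, congrArg (fun w : Plane => w 1) h1⟩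
  -- functions whose differential is a multiple of `du` depend on the first coordinate only
  have hcomp : ∀ {F : Plane → Space4} {w : Plane → Space4}, ContDiffOn ℝ ∞ F W →
      (∀ x ∈ W, ∀ i, pderivTwo i F x = inner ℝ (e x) (pderivTwo i X x) • w x) →
      ∀ y ∈ τ.target, HasFDerivAt (F ∘ τ.symm)
        ((EuclideanSpace.proj (0 : Fin 2) : Plane →L[ℝ] ℝ).smulRight (w (τ.symm y))) y := by
    intro F w hFs hFd y hy
    have hyW := hmem y hy
    have hsd : HasFDerivAt τ.symm (fderiv ℝ τ.symm y) y :=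
      (hτss.differentiableAt_of_isOpen τ.open_target hy).hasFDerivAt
    have hud := (hu.differentiableAt_of_isOpen hWo hyW).hasFDerivAt
    have h1 : (fderiv ℝ u (τ.symm y)).comp (fderiv ℝ τ.symm y) =
        (EuclideanSpace.proj (0 : Fin 2) : Plane →L[ℝ] ℝ) := by
      refine (hud.comp y hsd).unique ?_
      refine ((EuclideanSpace.proj (0 : Fin 2) : Plane →L[ℝ] ℝ).hasFDerivAt).congr_of_eventuallyEq ?_
      filter_upwards [τ.open_target.mem_nhds hy] with z hz
      exact (hinv z hz).1
    have h2 : fderiv ℝ F (τ.symm y) = (fderiv ℝ u (τ.symm y)).smulRight (w (τ.symm y)) := by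
      ext1 z
      rw [fderiv_eq_sum_pderivTwo, ContinuousLinearMap.smulRight_apply, fderiv_eq_sum_pderivTwo,
        Finset.sum_smul]
      simp only [hFd _ hyW, hdu _ hyW, smul_assoc]
    have h3 := (hFs.differentiableAt_of_isOpen hWo hyW).hasFDerivAt.comp y hsd
    convert! h3 using 1
    rw [h2, ← h1]
    rfl
  -- The horizontal line through the centre of the rectangle, on which the curve and its frame are
  -- read off.
  let ι : ℝ → Plane := fun s => s • EuclideanSpace.single 0 1 + v x₀ • EuclideanSpace.single 1 1
  have hι : ∀ s ∈ I, ι s ∈ τ.target := fun s hs => by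
    rw [hτt]
    exact ⟨by simpa [ι] using hs, by simpa [ι] using hvJ⟩
  have hιs : ContDiff ℝ ∞ ι := (contDiff_id.smul contDiff_const).add contDiff_const
  have hιd : ∀ s, HasDerivAt ι (EuclideanSpace.single 0 1) s := fun s => by
    have := ((hasDerivAt_id s).smul_const (EuclideanSpace.single 0 1 : Plane)).add_const
      (v x₀ • EuclideanSpace.single 1 1)
    rwa [one_smul] at this
  have hcurve : ∀ {F : Plane → Space4} {w : Plane → Space4}, ContDiffOn ℝ ∞ F W →
      (∀ x ∈ W, ∀ i, pderivTwo i F x = inner ℝ (e x) (pderivTwo i X x) • w x) →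
      ∀ s ∈ I, HasDerivAt (fun s => F (τ.symm (ι s))) (w (τ.symm (ι s))) s := by
    intro F w hFs hFd s hs
    have := (hcomp hFs hFd (ι s) (hι s hs)).comp_hasDerivAt s (hιd s)
    convert! this using 1
    simp
  -- The projection of the surface to the hyperplane orthogonal to the rulings; its differential is
  -- du ⊗ e.
  let Z : Plane → Space4 := fun x => X x - v x • e₀
  have hZ : ContDiffOn ℝ ∞ Z W := hXo.sub (hv.smul contDiffOn_const)
  have hZd : ∀ x ∈ W, ∀ i, pderivTwo i Z x = inner ℝ (e x) (pderivTwo i X x) • e x := by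
    intro x hx i
    have h1 := hXo.differentiableAt_of_isOpen hWo hx
    have h2 := hv.differentiableAt_of_isOpen hWo hx
    have h3 : pderivTwo i Z x = pderivTwo i X x - pderivTwo i v x • e₀ := by
      rw [pderivTwo, fderiv_fun_sub h1 (h2.smul_const _), fderiv_smul_const h2]
      rfl
    rw [h3, hdv x hx, hf x hx]
    conv_lhs => enter [1]; rw [hF.pderivTwo_eq (hball hx) i, hf x hx]
    rw [add_sub_cancel_right]
  have hmW : ∀ s ∈ I, τ.symm (ι s) ∈ W := fun s hs => hmem _ (hι s hs)
  have hfrx : ∀ s ∈ I, IsFrame (e (τ.symm (ι s))) e₀ (n (τ.symm (ι s))) (m (τ.symm (ι s))) := by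
    intro s hs
    rw [← hf _ (hmW s hs)]
    exact hF.frame _ (hball (hmW s hs))
  refine ⟨τ, I, J, fun s => Z (τ.symm (ι s)), fun s => e (τ.symm (ι s)), fun s => n (τ.symm (ι s)),
    fun s => m (τ.symm (ι s)), fun s => ρ (τ.symm (ι s)), e₀, hxτ, hτW.trans hball, hτs, hτss,
    Set.ordConnected_Ioo, isOpen_Ioo, Set.ordConnected_Ioo,
    ⟨u x₀, sub_lt_self _ hε, lt_add_of_pos_right _ hε⟩, hτt, ⟨isOpen_Ioo, ?_, hfrx, ?_, ?_, ?_, ?_⟩,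
    ?_, ?_⟩
  · exact hZ.comp (hτss.comp hιs.contDiffOn hι) hmW
  · exact hcurve hZ hZd
  · exact hcurve (w := fun x => (2 * h) • n x) hes fun x hx => hF.pderivTwo_e (hball hx) h0
  · exact hcurve (w := fun x => -(2 * h) • e x + ρ x • m x) (hF.contDiffOn_n.mono hball)
      fun x hx => hF.pderivTwo_n (hball hx)
  · exact fun s hs => hF.ρ_ne_zero _ (hball (hmW s hs))
  · intro s hs
    simp only [Z, v, inner_sub_left, real_inner_smul_left, (hfrx s hs).ff]
    rw [real_inner_comm]
    ring
  · intro y hy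
    have hDZ := hcomp hZ hZd
    have hyR : y 0 ∈ I ∧ y 1 ∈ J := by rw [hτt] at hy; exact hy
    have hEq : Z (τ.symm y) = Z (τ.symm (ι (y 0))) := by
      -- Along a vertical segment du vanishes, so `Z` keeps its value on the horizontal line.
      let κ : ℝ → Plane := fun t => y 0 • EuclideanSpace.single 0 1 + t • EuclideanSpace.single 1 1
      have hκ : ∀ t ∈ J, κ t ∈ τ.target := fun t ht => by
        rw [hτt]
        exact ⟨by simpa [κ] using hyR.1, by simpa [κ] using ht⟩
      have hκd : ∀ t, HasDerivAt κ (EuclideanSpace.single 1 1) t := fun t => by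
        have := ((hasDerivAt_id t).smul_const (EuclideanSpace.single 1 1 : Plane)).const_add
          (y 0 • EuclideanSpace.single 0 1)
        rwa [one_smul] at this
      have hd : ∀ t ∈ J, HasDerivAt (fun t => Z (τ.symm (κ t))) 0 t := by
        intro t ht
        have := (hDZ _ (hκ t ht)).comp_hasDerivAt t (hκd t)
        convert! this using 1
        simp
      have hc := isOpen_Ioo.is_const_of_deriv_eq_zero isPreconnected_Ioo
        (fun t ht => (hd t ht).differentiableAt.differentiableWithinAt)
        (fun t ht => (hd t ht).deriv) hyR.2 hvJ
      have hκy : κ (y 1) = y := by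
        ext i
        fin_cases i <;> simp [κ]
      rw [← hκy]
      simpa [κ, ι] using hc
    change X (τ.symm y) = Z (τ.symm (ι (y 0))) + y 1 • e₀
    rw [← hEq, ← (hinv y hy).2]
    simp [Z]

end ParamSurface.IsAdaptedFrame

/-! ### Curves in `ℝ³` and their Frenet frames -/

abbrev Space3 := EuclideanSpace ℝ (Fin 3)

/-- The cross product of `ℝ³`. -/
noncomputable def crossVec (t n : Space3) : Space3 := WithLp.toLp 2 (crossProduct t.ofLp n.ofLp)

theorem inner_space3 (v w : Space3) :
    inner ℝ v w = (v 0 * w 0 + v 1 * w 1 + v 2 * w 2 : ℝ) := by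
  simp [PiLp.inner_apply, Fin.sum_univ_three, mul_comm]

theorem crossVec_apply (t n : Space3) :
    crossVec t n 0 = t 1 * n 2 - t 2 * n 1 ∧ crossVec t n 1 = t 2 * n 0 - t 0 * n 2 ∧
      crossVec t n 2 = t 0 * n 1 - t 1 * n 0 := by
  simp [crossVec, cross_apply]

theorem inner_crossVec_self (t n : Space3) :
    inner ℝ (crossVec t n) (crossVec t n) =
      (inner ℝ t t * inner ℝ n n - inner ℝ t n ^ 2 : ℝ) := by
  obtain ⟨h0, h1, h2⟩ := crossVec_apply t n
  simp only [inner_space3, h0, h1, h2]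
  ring

theorem inner_crossVec_left (t n : Space3) : inner ℝ t (crossVec t n) = (0 : ℝ) := by
  obtain ⟨h0, h1, h2⟩ := crossVec_apply t n
  simp only [inner_space3, h0, h1, h2]
  ring

theorem inner_crossVec_right (t n : Space3) : inner ℝ n (crossVec t n) = (0 : ℝ) := by
  obtain ⟨h0, h1, h2⟩ := crossVec_apply t n
  simp only [inner_space3, h0, h1, h2]
  ring

/-- The squared triple product is the Gram determinant, here 1. A unit binormal is thus ± the cross
product; the sign is immaterial, since only the nonvanishing of the torsion matters. -/
theorem inner_crossVec_ne_zero {t n b : Space3} (htt : inner ℝ t t = (1 : ℝ))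
    (hnn : inner ℝ n n = (1 : ℝ)) (hbb : inner ℝ b b = (1 : ℝ)) (htn : inner ℝ t n = (0 : ℝ))
    (htb : inner ℝ t b = (0 : ℝ)) (hnb : inner ℝ n b = (0 : ℝ)) :
    inner ℝ b (crossVec t n) ≠ (0 : ℝ) := by
  have key : (inner ℝ b (crossVec t n) : ℝ) ^ 2 =
      inner ℝ t t * (inner ℝ n n * inner ℝ b b - inner ℝ n b ^ 2) -
        inner ℝ t n * (inner ℝ t n * inner ℝ b b - inner ℝ n b * inner ℝ t b) +
        inner ℝ t b * (inner ℝ t n * inner ℝ n b - inner ℝ n n * inner ℝ t b) := by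
    obtain ⟨h0, h1, h2⟩ := crossVec_apply t n
    simp only [inner_space3, h0, h1, h2]
    ring
  intro h
  rw [h, htt, hnn, hbb, htn, htb, hnb] at key
  norm_num at key

theorem eq_sum_crossVec {t n : Space3} (htt : inner ℝ t t = (1 : ℝ))
    (hnn : inner ℝ n n = (1 : ℝ)) (htn : inner ℝ t n = (0 : ℝ)) (v : Space3) :
    v = inner ℝ t v • t + inner ℝ n v • n + inner ℝ (crossVec t n) v • crossVec t n := by
  have hF : Orthonormal ℝ ![t, n, crossVec t n] := by
    have hcc := inner_crossVec_self t n
    rw [htt, hnn, htn] at hcc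
    norm_num only at hcc
    rw [orthonormal_iff_ite]
    intro i j
    fin_cases i <;> fin_cases j <;>
      simp [htt, hnn, htn, hcc, inner_crossVec_left, inner_crossVec_right, real_inner_comm t,
        real_inner_comm n, -inner_self_eq_norm_sq_to_K]
  simpa [Fin.sum_univ_three] using hF.eq_sum_of_card_eq_finrank (by simp) v

/-- The projection of `ℝ⁴` onto its first three coordinates. -/
noncomputable def dropLast : Space4 →L[ℝ] Space3 :=
  LinearMap.toContinuousLinearMap
    { toFun := fun w => !₂[w 0, w 1, w 2]
      map_add' := fun v w => by ext i; fin_cases i <;> simp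
      map_smul' := fun c w => by ext i; fin_cases i <;> simp }

/-- The inclusion of `ℝ³` in `ℝ⁴` as a coordinate hyperplane. -/
noncomputable def inclHyperplane : Space3 →L[ℝ] Space4 :=
  LinearMap.toContinuousLinearMap
    { toFun := fun w => !₂[w 0, w 1, w 2, 0]
      map_add' := fun v w => by ext i; fin_cases i <;> simp
      map_smul' := fun c w => by ext i; fin_cases i <;> simp }

theorem dropLast_apply (w : Space4) : dropLast w = !₂[w 0, w 1, w 2] := rfl

theorem inclHyperplane_apply (w : Space3) : inclHyperplane w = !₂[w 0, w 1, w 2, 0] := rfl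

theorem inner_space4 (v w : Space4) :
    inner ℝ v w = (v 0 * w 0 + v 1 * w 1 + v 2 * w 2 + v 3 * w 3 : ℝ) := by
  simp [PiLp.inner_apply, Fin.sum_univ_four, mul_comm]

theorem inner_dropLast {v : Space4} (hv : v 3 = 0) (w : Space4) :
    inner ℝ (dropLast v) (dropLast w) = (inner ℝ v w : ℝ) := by
  rw [inner_space3, inner_space4, hv, dropLast_apply, dropLast_apply]
  simp

theorem inner_inclHyperplane (v w : Space3) :
    inner ℝ (inclHyperplane v) (inclHyperplane w) = (inner ℝ v w : ℝ) := by
  rw [inner_space3, inner_space4, inclHyperplane_apply, inclHyperplane_apply]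
  simp

theorem inner_single_three (w : Space4) : inner ℝ (EuclideanSpace.single 3 1) w = w 3 := by
  rw [inner_space4]
  simp

theorem cylinderParam_eq (γ : ℝ → Space3) (a : ℝ) (x : Plane) :
    cylinderParam γ a x = inclHyperplane (γ (x 0)) + (x 1 + a) • EuclideanSpace.single 3 1 := by
  rw [inclHyperplane_apply]
  ext i
  fin_cases i <;> simp [cylinderParam]

/-- The reflection exchanging two vectors of equal length does this. -/
theorem exists_linearIsometryEquiv_apply_eq {e : Space4} (he : inner ℝ e e = (1 : ℝ)) :
    ∃ L : Space4 ≃ₗᵢ[ℝ] Space4, L e = EuclideanSpace.single 3 1 := by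
  refine ⟨_, Submodule.reflection_sub (v := e) (w := EuclideanSpace.single 3 1) ?_⟩
  rw [norm_eq_sqrt_real_inner, he]
  simp

/-- Putting the hyperplane of a Frenet curve in standard position. -/
theorem IsFrenetCurve.isConstCurvatureTwistedCurve {I : Set ℝ} {C T N B : ℝ → Space4} {τ : ℝ → ℝ}
    {e : Space4} {k : ℝ} (hC : IsFrenetCurve I C T N B τ e k) (hk : 0 < k)
    {L : Space4 ≃ₗᵢ[ℝ] Space4} (hL : L e = EuclideanSpace.single 3 1) :
    IsConstCurvatureTwistedCurve I (fun s => dropLast (L (C s))) k := by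
  let Q : Space4 →L[ℝ] Space3 := dropLast.comp (L : Space4 →L[ℝ] Space4)
  -- Dropping the last coordinate preserves an inner product as soon as one factor lies in the
  -- hyperplane.
  have hQ : ∀ v w, inner ℝ e v = (0 : ℝ) → inner ℝ (Q v) (Q w) = (inner ℝ v w : ℝ) := by
    intro v w hv
    have : L v 3 = 0 := by rw [← inner_single_three, ← hL, L.inner_map_map, hv]
    rw [← L.inner_map_map]
    exact inner_dropLast this _
  have het : ∀ s ∈ I, inner ℝ e (T s) = (0 : ℝ) := fun s hs => by
    rw [real_inner_comm, (hC.frame s hs).ef]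
  have hdQ : ∀ {F : ℝ → Space4} {F' : Space4} {s : ℝ}, HasDerivAt F F' s →
      HasDerivAt (fun s => Q (F s)) (Q F') s := fun h => Q.hasFDerivAt.comp_hasDerivAt _ h
  have hd1 : ∀ s ∈ I, HasDerivAt (fun s => Q (C s)) (Q (T s)) s := fun s hs =>
    hdQ (hC.deriv_curve s hs)
  have hd1' : Set.EqOn (deriv fun s => Q (C s)) (fun s => Q (T s)) I := fun s hs => (hd1 s hs).deriv
  have hd2' : ∀ s ∈ I, deriv (deriv fun s => Q (C s)) s = k • Q (N s) := by
    intro s hs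
    rw [(hd1'.eventuallyEq_of_mem (hC.isOpen.mem_nhds hs)).deriv_eq,
      (hdQ (hC.deriv_tangent s hs)).deriv, map_smul]
  have hcurv : ∀ s ∈ I, ArcLengthCurve.curvature (fun s => Q (C s)) s = k := by
    intro s hs
    rw [ArcLengthCurve.curvature, hd2' s hs, norm_smul, Real.norm_of_nonneg hk.le,
      norm_eq_sqrt_real_inner, hQ _ _ (hC.frame s hs).fn, (hC.frame s hs).nn]
    simp
  have hpn : Set.EqOn (ArcLengthCurve.principalNormal fun s => Q (C s)) (fun s => Q (N s)) I := by
    intro s hs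
    simp only [ArcLengthCurve.principalNormal, hcurv s hs, hd2' s hs]
    rw [inv_smul_smul₀ hk.ne']
  refine ⟨Q.contDiff.comp_contDiffOn hC.contDiffOn, fun s hs => ?_, hcurv, fun s hs => ?_⟩
  · change ‖deriv (fun s => Q (C s)) s‖ = 1
    rw [(hd1 s hs).deriv, norm_eq_sqrt_real_inner, hQ _ _ (het s hs), (hC.frame s hs).ee]
    simp
  · have hF := hC.frame s hs
    have h1 : ArcLengthCurve.binormal (fun s => Q (C s)) s = crossVec (Q (T s)) (Q (N s)) := by
      rw [ArcLengthCurve.binormal, hpn hs, (hd1 s hs).deriv]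
      rfl
    have h2 : deriv (ArcLengthCurve.principalNormal fun s => Q (C s)) s =
        -k • Q (T s) + τ s • Q (B s) := by
      rw [(hpn.eventuallyEq_of_mem (hC.isOpen.mem_nhds hs)).deriv_eq,
        (hdQ (hC.deriv_normal s hs)).deriv, map_add, map_smul, map_smul]
    change ArcLengthCurve.torsion (fun s => Q (C s)) s ≠ 0
    rw [ArcLengthCurve.torsion, h1, h2, inner_add_left, real_inner_smul_left, real_inner_smul_left,
      inner_crossVec_left, mul_zero, zero_add]
    refine mul_ne_zero (hC.torsion_ne_zero s hs) (inner_crossVec_ne_zero ?_ ?_ ?_ ?_ ?_ ?_)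
    · rw [hQ _ _ (het s hs), hF.ee]
    · rw [hQ _ _ hF.fn, hF.nn]
    · rw [hQ _ _ hF.fm, hF.mm]
    · rw [hQ _ _ (het s hs), hF.en]
    · rw [hQ _ _ (het s hs), hF.em]
    · rw [hQ _ _ hF.fn, hF.nm]

/-- The Frenet frame of a curve of constant curvature, moved by a rigid motion of `ℝ⁴`. -/
theorem IsConstCurvatureTwistedCurve.isFrenetCurve {I : Set ℝ} (hI : IsOpen I) {γ : ℝ → Space3}
    {k : ℝ} (hγ : IsConstCurvatureTwistedCurve I γ k) (hk : k ≠ 0) (L : Space4 ≃ₗᵢ[ℝ] Space4)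
    (c : Space4) :
    IsFrenetCurve I (fun s => L (inclHyperplane (γ s)) + c) (fun s => L (inclHyperplane (deriv γ s)))
      (fun s => L (inclHyperplane (ArcLengthCurve.principalNormal γ s)))
      (fun s => L (inclHyperplane (ArcLengthCurve.binormal γ s))) (ArcLengthCurve.torsion γ)
      (L (EuclideanSpace.single 3 1)) k := by
  let Q : Space3 →L[ℝ] Space4 := (L : Space4 →L[ℝ] Space4).comp inclHyperplane
  have hs1 : ContDiffOn ℝ ∞ (deriv γ) I := hγ.contDiffOn.deriv_of_isOpen hI (by simp)
  have hs2 : ContDiffOn ℝ ∞ (deriv (deriv γ)) I := hs1.deriv_of_isOpen hI (by simp)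
  have hda : ∀ {F : ℝ → Space3}, ContDiffOn ℝ ∞ F I → ∀ s ∈ I, HasDerivAt F (deriv F s) s :=
    fun hF s hs => ((hF.contDiffAt (hI.mem_nhds hs)).differentiableAt (by simp)).hasDerivAt
  have hconst : ∀ {F G : ℝ → Space3}, ContDiffOn ℝ ∞ F I → ContDiffOn ℝ ∞ G I → ∀ {c : ℝ},
      (∀ s ∈ I, inner ℝ (F s) (G s) = c) → ∀ s ∈ I,
      (inner ℝ (F s) (deriv G s) + inner ℝ (deriv F s) (G s) : ℝ) = 0 := by
    intro F G hF hG c hc s hs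
    rw [← ((hda hF s hs).inner ℝ (hda hG s hs)).deriv,
      (Set.EqOn.eventuallyEq_of_mem (g := fun _ => c) hc (hI.mem_nhds hs)).deriv_eq, deriv_const]
  have hpn : Set.EqOn (ArcLengthCurve.principalNormal γ) (fun s => k⁻¹ • deriv (deriv γ) s) I :=
    fun s hs => by simp only [ArcLengthCurve.principalNormal, hγ.curvature_eq s hs]
  have hs3 : ContDiffOn ℝ ∞ (ArcLengthCurve.principalNormal γ) I := (hs2.const_smul k⁻¹).congr hpn
  have hd2 : ∀ s ∈ I, deriv (deriv γ) s = k • ArcLengthCurve.principalNormal γ s := fun s hs => by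
    rw [hpn hs]
    simp only
    rw [smul_inv_smul₀ hk]
  have htt : ∀ s ∈ I, inner ℝ (deriv γ s) (deriv γ s) = (1 : ℝ) := fun s hs => by
    rw [real_inner_self_eq_norm_sq, hγ.norm_deriv s hs, one_pow]
  have hnn : ∀ s ∈ I, inner ℝ (ArcLengthCurve.principalNormal γ s)
      (ArcLengthCurve.principalNormal γ s) = (1 : ℝ) := fun s hs => by
    have h1 : ‖deriv (deriv γ) s‖ = k := hγ.curvature_eq s hs
    rw [hpn hs, real_inner_smul_left, real_inner_smul_right, real_inner_self_eq_norm_sq, h1]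
    field_simp
  have htn : ∀ s ∈ I, inner ℝ (deriv γ s) (ArcLengthCurve.principalNormal γ s) = (0 : ℝ) := by
    intro s hs
    have := hconst hs1 hs1 htt s hs
    rw [real_inner_comm (deriv γ s) (deriv (deriv γ) s), hd2 s hs, real_inner_smul_right] at this
    refine (mul_eq_zero.1 (?_ : k * _ = 0)).resolve_left hk
    linarith
  have hdn : ∀ s ∈ I, deriv (ArcLengthCurve.principalNormal γ) s =
      -k • deriv γ s + ArcLengthCurve.torsion γ s • ArcLengthCurve.binormal γ s := by
    intro s hs
    have h1 := hconst hs1 hs3 htn s hs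
    have h2 := hconst hs3 hs3 hnn s hs
    rw [hd2 s hs, real_inner_smul_left, hnn s hs] at h1
    rw [real_inner_comm (ArcLengthCurve.principalNormal γ s)
      (deriv (ArcLengthCurve.principalNormal γ) s)] at h2
    -- Differentiating ⟨T, N⟩ = 0 and |N|² = 1 gives the components -k and 0 of N'; the third is the
    -- torsion by definition.
    have h3 := eq_sum_crossVec (htt s hs) (hnn s hs) (htn s hs)
      (deriv (ArcLengthCurve.principalNormal γ) s)
    rw [(by linarith : inner ℝ (deriv γ s) (deriv (ArcLengthCurve.principalNormal γ) s) = -k),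
      (by linarith : inner ℝ (ArcLengthCurve.principalNormal γ s)
        (deriv (ArcLengthCurve.principalNormal γ) s) = (0 : ℝ)), real_inner_comm, zero_smul,
      add_zero] at h3
    exact h3
  have hbin : ∀ s, ArcLengthCurve.binormal γ s =
    crossVec (deriv γ s) (ArcLengthCurve.principalNormal γ s) := fun s => rfl
  have hQe : ∀ v : Space3, inner ℝ (inclHyperplane v) (EuclideanSpace.single 3 1) = (0 : ℝ) :=
    fun v => by
      rw [real_inner_comm, inner_single_three, inclHyperplane_apply]
      simp
  refine ⟨hI, (Q.contDiff.comp_contDiffOn hγ.contDiffOn).add contDiffOn_const, fun s hs => ?_,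
    fun s hs => ?_, fun s hs => ?_, fun s hs => ?_, hγ.torsion_ne_zero⟩
  · have hcc := inner_crossVec_self (deriv γ s) (ArcLengthCurve.principalNormal γ s)
    rw [htt s hs, hnn s hs, htn s hs] at hcc
    constructor <;> simp only [L.inner_map_map, inner_inclHyperplane, hbin]
    · exact htt s hs
    · simp
    · exact hnn s hs
    · rw [hcc]; norm_num
    · exact hQe _
    · exact htn s hs
    · exact inner_crossVec_left _ _
    · rw [real_inner_comm, hQe]
    · rw [real_inner_comm, hQe]
    · exact inner_crossVec_right _ _
  · exact (Q.hasFDerivAt.comp_hasDerivAt s (hda hγ.contDiffOn s hs)).add_const c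
  · have := Q.hasFDerivAt.comp_hasDerivAt s (hda hs1 s hs)
    rw [hd2 s hs, map_smul] at this
    exact this
  · have := Q.hasFDerivAt.comp_hasDerivAt s (hda hs3 s hs)
    rw [hdn s hs, map_add, map_smul, map_smul] at this
    exact this

/-! ### Charts of the surface -/

section Charts

open ParamSurface

variable {M : Type*} [TopologicalSpace M] [ChartedSpace Plane M] [IsManifold (𝓡 2) ∞ M]
  {φ : M → Space4} {c : OpenPartialHomeomorph M Plane}

theorem linearIndependent_pderivTwo_of_injective {X : Plane → Space4} {x : Plane}
    (h : Function.Injective (fderiv ℝ X x)) : LinearIndependent ℝ fun i => pderivTwo i X x := by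
  convert! (EuclideanSpace.basisFun (Fin 2) ℝ).orthonormal.linearIndependent.map'
    (fderiv ℝ X x).toLinearMap (LinearMap.ker_eq_bot.2 h) using 1
  ext1 i
  simp [pderivTwo]

theorem injective_fderiv_of_linearIndependent {X : Plane → Space4} {x : Plane}
    (h : LinearIndependent ℝ fun i => pderivTwo i X x) : Function.Injective (fderiv ℝ X x) := by
  rw [injective_iff_map_eq_zero]
  intro w hw
  rw [fderiv_eq_sum_pderivTwo] at hw
  ext i
  exact Fintype.linearIndependent_iff.1 h _ hw i

theorem IsSmoothImmersion.isRegularOn (hφ : IsSmoothImmersion φ) (hc : c ∈ atlas Plane M) :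
    IsRegularOn (φ ∘ c.symm) c.target := by
  have hcm := IsManifold.subset_maximalAtlas (I := 𝓡 2) (n := ∞) hc
  refine ⟨c.open_target, ?_, fun x hx => linearIndependent_pderivTwo_of_injective ?_⟩
  · rw [← contMDiffOn_iff_contDiffOn]
    exact hφ.1.comp_contMDiffOn (contMDiffOn_symm_of_mem_maximalAtlas hcm)
  · have : IsManifold (𝓡 2) 1 M := IsManifold.of_le (n := ∞) (by simp)
    have hmd := mdifferentiable_of_mem_atlas (I := 𝓡 2) hc
    have h1 := hmd.mdifferentiableAt_symm hx
    have h2 : MDifferentiableAt (𝓡 2) 𝓘(ℝ, Space4) φ (c.symm x) :=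
      hφ.1.mdifferentiableAt (by simp)
    rw [← mfderiv_eq_fderiv, mfderiv_comp x h2 h1]
    exact (hφ.2 _).comp (hmd.symm.mfderiv_injective hx)

theorem IsSmoothImmersion.of_isRegularOn
    (h : ∀ p : M, ∃ U, chartAt Plane p p ∈ U ∧
      IsRegularOn (φ ∘ (chartAt Plane p).symm) U) : IsSmoothImmersion φ := by
  have heq : ∀ p : M, φ =ᶠ[nhds p] (φ ∘ (chartAt Plane p).symm) ∘ chartAt Plane p := by
    intro p
    filter_upwards [(chartAt Plane p).open_source.mem_nhds (mem_chart_source Plane p)] with q hq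
    simp [(chartAt Plane p).left_inv hq]
  have : IsManifold (𝓡 2) 1 M := IsManifold.of_le (n := ∞) (by simp)
  refine ⟨fun p => ?_, fun p => ?_⟩
  · obtain ⟨U, hpU, hU⟩ := h p
    have h1 : ContMDiffAt 𝓘(ℝ, Plane) 𝓘(ℝ, Space4) ∞ (φ ∘ (chartAt Plane p).symm)
        (chartAt Plane p p) := (hU.contDiffOn.contDiffAt (hU.isOpen.mem_nhds hpU)).contMDiffAt
    have h2 : ContMDiffAt (𝓡 2) 𝓘(ℝ, Plane) ∞ (chartAt Plane p) p :=
      contMDiffAt_of_mem_maximalAtlas (IsManifold.chart_mem_maximalAtlas p) (mem_chart_source _ p)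
    exact (h1.comp p h2).congr_of_eventuallyEq (heq p)
  · obtain ⟨U, hpU, hU⟩ := h p
    have hmd := mdifferentiable_chart (I := 𝓡 2) (H := Plane) p
    have h1 : MDifferentiableAt 𝓘(ℝ, Plane) 𝓘(ℝ, Space4) (φ ∘ (chartAt Plane p).symm)
        (chartAt Plane p p) :=
      (hU.contDiffOn.differentiableAt_of_isOpen hU.isOpen hpU).mdifferentiableAt
    rw [(heq p).mfderiv_eq, mfderiv_comp p h1 (hmd.mdifferentiableAt (mem_chart_source _ p)),
      mfderiv_eq_fderiv]
    exact (injective_fderiv_of_linearIndependent (hU.linearIndependent _ hpU)).comp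
      (hmd.mfderiv_injective (mem_chart_source _ p))

/-- A biconservative surface with nonzero constant `|H|` is a cylinder near every point where
`∇^⊥ H` does not vanish. -/
theorem exists_isTwistedCylinderNear (hφ : IsSmoothImmersion φ) (hb : IsBiconservative φ)
    (hH : HasNonzeroConstantMeanCurvature φ) {p : M} (hp : ¬ IsParallelMeanCurvatureAt φ p) :
    ∃ k : ℝ, k ≠ 0 ∧ IsTwistedCylinderNear φ k p := by
  obtain ⟨h, h0, hh⟩ := hH
  set c := chartAt Plane p with hc
  have hca : c ∈ atlas Plane M := chart_mem_atlas Plane p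
  have hpc : p ∈ c.source := mem_chart_source Plane p
  have hpt : c p ∈ c.target := c.map_source hpc
  -- Positivity is needed because the curvature of a space curve is a norm and must equal 2h.
  have hhpos : 0 < h := lt_of_le_of_ne (by rw [← hh c hca _ hpt]; exact norm_nonneg _) h0.symm
  obtain ⟨i₀, hi₀⟩ := not_forall.1 hp
  obtain ⟨V, e, f, n, m, ρ, hpV, hVc, hF⟩ := exists_isAdaptedFrame (hφ.isRegularOn hca)
    (hb c hca) h0 (hh c hca) hpt hi₀
  obtain ⟨τ, I, J, C, T, N, B, t, e₀, hpτ, hτV, hτ, hτs, hIc, hJ, hJc, ⟨s₀, hs₀⟩, hτt, hC, hCe, hX⟩ :=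
    hF.exists_cylinder_chart h0 hpV
  obtain ⟨L, hL⟩ := exists_linearIsometryEquiv_apply_eq (hC.frame s₀ hs₀).ff
  have hτc : τ.source ⊆ c.target := hτV.trans hVc
  have htt : (c.trans τ).target = τ.target := by
    rw [OpenPartialHomeomorph.trans_target]
    exact Set.inter_eq_left.2 fun y hy => hτc (τ.map_target hy)
  have hcm := IsManifold.subset_maximalAtlas (I := 𝓡 2) (n := ∞) hca
  refine ⟨2 * h, by positivity, L.toAffineIsometryEquiv, I, J, fun s => dropLast (L (C s)), 0,
    c.trans τ, hC.isOpen, hIc, hJ, hJc, hC.isConstCurvatureTwistedCurve (by positivity) hL, ?_, ?_,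
    htt.trans hτt, fun y hy => ?_⟩
  · refine (c.trans τ).mem_maximalAtlas_of_contMDiffOn ?_ ?_
    · exact (contMDiffOn_iff_contDiffOn.2 hτ).comp
        ((contMDiffOn_of_mem_maximalAtlas hcm).mono fun x hx => hx.1) fun x hx => hx.2
    · rw [htt]
      exact (contMDiffOn_symm_of_mem_maximalAtlas hcm).comp (contMDiffOn_iff_contDiffOn.2 hτs)
        fun y hy => hτc (τ.map_target hy)
  · exact ⟨hpc, hpτ⟩
  · rw [htt] at hy
    have hyI : y 0 ∈ I := by rw [hτt] at hy; exact hy.1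
    have h1 : φ ((c.trans τ).symm y) = C (y 0) + y 1 • e₀ := hX y hy
    have h2 : L (C (y 0)) 3 = 0 := by
      rw [← inner_single_three, ← hL, L.inner_map_map, real_inner_comm, hCe _ hyI]
    have h3 : inclHyperplane (dropLast (L (C (y 0)))) = L (C (y 0)) := by
      rw [inclHyperplane_apply, dropLast_apply]
      ext i
      fin_cases i <;> simp [h2]
    rw [h1, cylinderParam_eq, h3, add_zero]
    change L _ = _
    rw [map_add, map_smul, hL]

/-- The tensors are computed in charts of the atlas, while the cylinder coordinates belong only to
the maximal atlas. Composing with the transition map expresses u and v as functions on the given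
chart. -/
theorem IsTwistedCylinderNear.exists_isRegularOn {k : ℝ} (hk : k ≠ 0)
    (hφ : ∀ p, IsTwistedCylinderNear φ k p) (hc : c ∈ atlas Plane M) {x : Plane}
    (hx : x ∈ c.target) :
    ∃ U, x ∈ U ∧ IsRegularOn (φ ∘ c.symm) U ∧ ‖meanCurvature (φ ∘ c.symm) x‖ = |k / 2| ∧
      (∀ i, divStress (φ ∘ c.symm) i x = 0) ∧
      ∃ i, normalDerivMeanCurvature (φ ∘ c.symm) i x ≠ 0 := by
  obtain ⟨Φ, I, J, γ, a, e, hI, -, -, -, hγ, he, hpe, hte, hcyl⟩ := hφ (c.symm x)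
  have hcm := IsManifold.subset_maximalAtlas (I := 𝓡 2) (n := ∞) hc
  let τ := c.symm.trans e
  have hτ : ContDiffOn ℝ ∞ τ τ.source := by
    rw [← contMDiffOn_iff_contDiffOn]
    exact (contMDiffOn_of_mem_maximalAtlas he).comp
      ((contMDiffOn_symm_of_mem_maximalAtlas hcm).mono fun y hy => hy.1) fun y hy => hy.2
  have hτs : ContDiffOn ℝ ∞ τ.symm τ.target := by
    rw [← contMDiffOn_iff_contDiffOn]
    exact (contMDiffOn_of_mem_maximalAtlas hcm).comp
      ((contMDiffOn_symm_of_mem_maximalAtlas he).mono fun y hy => hy.1) fun y hy => hy.2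
  have hxτ : x ∈ τ.source := ⟨hx, hpe⟩
  let u : Plane → ℝ := fun y => τ y 0
  let v : Plane → ℝ := fun y => τ y 1 + a
  have hu : ContDiffOn ℝ ∞ u τ.source := contDiffOn_euclidean.1 hτ 0
  have hv : ContDiffOn ℝ ∞ v τ.source := (contDiffOn_euclidean.1 hτ 1).add contDiffOn_const
  have hmem : ∀ y ∈ τ.source, τ y ∈ e.target := fun y hy => e.map_source hy.2
  have huI : ∀ y ∈ τ.source, u y ∈ I := fun y hy => by
    have := hmem y hy
    rw [hte] at this
    exact this.1
  -- By the chain rule, this Jacobian times that of the inverse transition map is 1.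
  have hd : ∀ y ∈ τ.source,
      pderivTwo 0 u y * pderivTwo 1 v y - pderivTwo 1 u y * pderivTwo 0 v y ≠ 0 := by
    intro y hy
    have h1 : HasFDerivAt τ.symm (fderiv ℝ τ.symm (τ y)) (τ y) :=
      (hτs.differentiableAt_of_isOpen τ.open_target (τ.map_source hy)).hasFDerivAt
    have hcomp : ∀ {g : Plane → ℝ} {g' : Plane →L[ℝ] ℝ}, ContDiffOn ℝ ∞ g τ.source →
        HasFDerivAt (g ∘ τ.symm) g' (τ y) → ∀ w,
        ∑ i, fderiv ℝ τ.symm (τ y) w i * pderivTwo i g y = g' w := by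
      intro g g' hg hg' w
      have h2 : HasFDerivAt g (fderiv ℝ g y) (τ.symm (τ y)) := by
        rw [τ.left_inv hy]
        exact (hg.differentiableAt_of_isOpen τ.open_source hy).hasFDerivAt
      rw [hg'.unique (h2.comp _ h1), ContinuousLinearMap.comp_apply, fderiv_eq_sum_pderivTwo g]
      rfl
    have hev := τ.open_target.mem_nhds (τ.map_source hy)
    have hu' : HasFDerivAt (u ∘ τ.symm) (EuclideanSpace.proj (0 : Fin 2) : Plane →L[ℝ] ℝ) (τ y) := by
      refine (ContinuousLinearMap.hasFDerivAt _).congr_of_eventuallyEq ?_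
      filter_upwards [hev] with z hz
      simp [u, τ.right_inv hz]
    have hv' : HasFDerivAt (v ∘ τ.symm) (EuclideanSpace.proj (1 : Fin 2) : Plane →L[ℝ] ℝ) (τ y) := by
      refine ((ContinuousLinearMap.hasFDerivAt (EuclideanSpace.proj (1 : Fin 2) :
        Plane →L[ℝ] ℝ)).add_const a).congr_of_eventuallyEq ?_
      filter_upwards [hev] with z hz
      simp [v, τ.right_inv hz]
    have a0 := hcomp hu hu' (EuclideanSpace.single 0 1)
    have a1 := hcomp hu hu' (EuclideanSpace.single 1 1)
    have b0 := hcomp hv hv' (EuclideanSpace.single 0 1)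
    have b1 := hcomp hv hv' (EuclideanSpace.single 1 1)
    simp only [Fin.sum_univ_two] at a0 a1 b0 b1
    simp at a0 a1 b0 b1
    intro h0
    set A := fderiv ℝ τ.symm (τ y) (EuclideanSpace.single 0 1)
    set D := fderiv ℝ τ.symm (τ y) (EuclideanSpace.single 1 1)
    have : (1 : ℝ) = 0 := by
      linear_combination (A 0 * D 1 - A 1 * D 0) * h0 -
        (D 0 * pderivTwo 0 v y + D 1 * pderivTwo 1 v y) * a0 - b1 +
        (D 0 * pderivTwo 0 u y + D 1 * pderivTwo 1 u y) * b0
    exact one_ne_zero this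
  have hC := hγ.isFrenetCurve hI hk Φ.symm.linearIsometryEquiv (Φ.symm 0)
  have hX : ∀ y ∈ τ.source, (φ ∘ c.symm) y =
      Φ.symm.linearIsometryEquiv (inclHyperplane (γ (u y))) + Φ.symm 0 +
        v y • Φ.symm.linearIsometryEquiv (EuclideanSpace.single 3 1) := by
    intro y hy
    have h1 := hcyl _ (hmem y hy)
    have h2 : e.symm (τ y) = c.symm y := e.left_inv hy.2
    have h3 : ∀ w : Space4, Φ.symm w = Φ.symm.linearIsometryEquiv w + Φ.symm 0 := fun w => by
      have := Φ.symm.map_vadd 0 w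
      simpa using this
    rw [h2] at h1
    rw [Function.comp_apply, ← Φ.symm_apply_apply (φ (c.symm y)), h1, h3, cylinderParam_eq, map_add,
      map_smul]
    simp only [u, v]
    abel
  obtain ⟨hreg, hH, hD, hdiv⟩ := cylinder_geometry hC τ.open_source hu hv huI hd hX
  have hF := hC.frame _ (huI x hxτ)
  refine ⟨τ.source, hxτ, hreg, ?_, hdiv x hxτ, ?_⟩
  · rw [hH x hxτ, norm_smul, Real.norm_eq_abs, norm_eq_sqrt_real_inner, hF.nn]
    simp
  -- Since k and the torsion are nonzero, ∇^⊥H = 0 would force du = 0, against the Jacobian.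
  · by_contra! hcon
    have h1 : ∀ i, pderivTwo i u x = 0 := by
      intro i
      have h2 := hcon i
      rw [hD x hxτ] at h2
      have h3 := (smul_eq_zero.1 h2).resolve_right fun h4 => by
        have := hF.mm
        rw [h4] at this
        simp at this
      refine (mul_eq_zero.1 h3).resolve_left ?_
      exact mul_ne_zero (by simpa using hk) (hC.torsion_ne_zero _ (huI x hxτ))
    apply hd x hxτ
    rw [h1, h1]
    ring

end Charts

theorem mainTheorem3 {M : Type*} [TopologicalSpace M]
    [ChartedSpace (EuclideanSpace ℝ (Fin 2)) M] [IsManifold (𝓡 2) ∞ M]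
    (φ : M → EuclideanSpace ℝ (Fin 4)) :
    (IsSmoothImmersion φ → IsBiconservative φ → HasNonzeroConstantMeanCurvature φ →
      ∀ p : M, ¬ IsParallelMeanCurvatureAt φ p →
        ∃ k : ℝ, k ≠ 0 ∧ IsTwistedCylinderNear φ k p) ∧
    ((∃ k : ℝ, k ≠ 0 ∧ ∀ p : M, IsTwistedCylinderNear φ k p) →
      IsSmoothImmersion φ ∧ IsBiconservative φ ∧ HasNonzeroConstantMeanCurvature φ ∧
        ∀ p : M, ¬ IsParallelMeanCurvatureAt φ p) := by
  refine ⟨fun hφ hb hH p hp => exists_isTwistedCylinderNear hφ hb hH hp, ?_⟩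
  rintro ⟨k, hk, hcyl⟩
  have key := fun (c : OpenPartialHomeomorph M Plane) (hc : c ∈ atlas Plane M) (x : Plane)
    (hx : x ∈ c.target) => IsTwistedCylinderNear.exists_isRegularOn hk hcyl hc hx
  have hmem := fun p : M => (chartAt Plane p).map_source (mem_chart_source Plane p)
  refine ⟨IsSmoothImmersion.of_isRegularOn fun p => ?_, fun c hc x hx i => ?_,
    -- The common curvature `k` gives one constant for all charts; `M` is not assumed connected.
    ⟨|k / 2|, by simpa using hk, fun c hc x hx => ?_⟩, fun p hp => ?_⟩
  · obtain ⟨U, hU, hreg, -⟩ := key _ (chart_mem_atlas Plane p) _ (hmem p)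
    exact ⟨U, hU, hreg⟩
  · obtain ⟨U, -, -, -, hdiv, -⟩ := key c hc x hx
    exact hdiv i
  · obtain ⟨U, -, -, hn, -⟩ := key c hc x hx
    exact hn
  · obtain ⟨U, -, -, -, -, i, hi⟩ := key _ (chart_mem_atlas Plane p) _ (hmem p)
    exact hi (hp i)
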